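/- **Executions and strong linearisability.** Threads take atomic steps over shared memory, each following its state machine; executions are finite interleavings of such steps from the initial state. The history of an execution is its subsequence of invoke and response steps. A linearisation of an execution $\sigma$ with respect to a set $\mathit{Spec}$ of sequential histories is an $H\in\mathit{Spec}$ such that, after adding responses to some pending invocations of $\sigma$ and removing the others, $H$ and $\sigma$ consist of the same invocations and responses, and $H$ preserves the order of non-overlapping operations of $\sigma$. An algorithm is *strongly linearisable* with respect to $\mathit{Spec}$ if there is a function $f$ that maps each execution $\sigma$ to a linearisation of $\sigma$ and is prefix preserving: if $\sigma$ is a prefix of $\sigma'$, then $f(\sigma)$ is a prefix of $f(\sigma')$. **Relaxation.** A sequential history $H$ is an $r$-relaxation of a sequential history $H'$ if $H$ consists of all but at most $r$ invocations of $H'$ with their responses, and each invocation in $H$ is preceded in $H$ by all but at most $r$ of the invocations that precede it in $H'$. For a set $\mathit{Spec}$ of sequential histories, $\mathit{Spec}^r=\{H' : \text{some } H\in \mathit{Spec} \text{ is an } r\text{-relaxation of } H'\}$. **Composable sketches.** A derandomised sketch (all random choices are fixed by an oracle: those made at initialisation are part of the empty state, and coins supplied with an update are part of its argument) has an empty state and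 deterministic methods $\mathrm{update}(a)$ and $\mathrm{query}(x)$. $\mathit{SeqSketch}$ is the set of its sequential histories of updates and queries, started from the empty state. A state *summarises* the stream $a_1,\dots,a_n$ if it is the state reached from the empty state by $\mathrm{update}(a_1),\dots,\mathrm{update}(a_n)$. The sketch is *composable* if moreover it has the following. - A method $\mathrm{merge}$: if $s$ summarises $A$ and $s'$ summarises $A'$, then $s.\mathrm{merge}(s')$ summarises $A\|A'$. - A method $\mathrm{calcHint}$ that returns a hint $\ne 0$ on every state that summarises a stream, and a static predicate $\mathrm{shouldAdd}$ such that if $s$ summarises $A$ and $\mathrm{shouldAdd}(s.\mathrm{calcHint}(),a)$ is false, then for all streams $B_1,B_2$, every state that summarises $A\|B_1\|a\|B_2$ also summarises $A\|B_1\|B_2$. The initial hint $1\neq 0$ has this property for the empty stream $A$: if $\mathrm{shouldAdd}(1,a)$ is false, then every state that summarises $B_1\|a\|B_2$ also summarises $B_1\|B_2$. - A method $\mathrm{snapshot}$ that returns a copy which answers every query as the sketch does at that moment. - A concurrent implementation of a shared, initially empty sketch (each operation may take many steps) that is strongly linearisable with respect to the sequential behaviour of $\mathrm{merge}$, $\mathrm{calcHint}$,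 $\mathrm{snapshot}$ in all executions in which one thread invokes merges (with arguments that summarise some stream) and $\mathrm{calcHint}$, and other threads invoke snapshots. **The algorithm $\mathit{OptParSketch}$**, with update threads $t_1,\dots,t_N$, a propagator thread, an arbitrary set of query threads, and buffer size $b\ge 1$. The shared sketch is $\mathit{globalS}$, initially empty. For each $i$ there are sketches $\mathit{localS}_i[0],\mathit{localS}_i[1]$, initially empty, $\mathit{cur}_i=0$, $\mathit{counter}_i=0$, $\mathit{hint}_i=1$, and an atomic variable $\mathit{prop}_i=1$. - $\mathrm{update}_i(a)$, by $t_i$: if $\mathrm{shouldAdd}(\mathit{hint}_i,a)$ is false, return. Otherwise $\mathit{counter}_i\leftarrow\mathit{counter}_i+1$; $\mathit{localS}_i[\mathit{cur}_i].\mathrm{update}(a)$; and if now $\mathit{counter}_i=b$: wait until $\mathit{prop}_i\ne0$; $\mathit{cur}_i\leftarrow1-\mathit{cur}_i$; $\mathit{hint}_i\leftarrow\mathit{prop}_i$; $\mathit{counter}_i\leftarrow0$; $\mathit{prop}_i\leftarrow0$. Return. - Propagator, forever: for an $i$ with $\mathit{prop}_i=0$: $\mathit{globalS}.\mathrm{merge}(\mathit{localS}_i[1-\mathit{cur}_i])$;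 $\mathit{localS}_i[1-\mathit{cur}_i]\leftarrow$ empty sketch; $\mathit{prop}_i\leftarrow\mathit{globalS}.\mathrm{calcHint}()$. - $\mathrm{query}(x)$, by a query thread: $\mathit{localCopy}\leftarrow\mathit{globalS}.\mathrm{snapshot}()$; return $\mathit{localCopy}.\mathrm{query}(x)$. **Theorem.** For all $N$ and all $b\ge1$, $\mathit{OptParSketch}$ instantiated with a composable sketch with sequential specification $\mathit{SeqSketch}$ is strongly linearisable with respect to $\mathit{SeqSketch}^{2Nb}$. -/

import Mathlib

/-! ## Threads, steps, executions, histories -/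

/-- What a step of a thread does: it invokes an operation, it responds to the thread's pending
operation, or it is internal. -/
inductive StepAction (I R : Type*) where
  | inv (i : I)
  | res (r : R)
  | tau

/-- An algorithm run by threads `T` that implements an object with invocations `I` and responses
`R`: `Step s t α s'` says that in global state `s` thread `t` can take a step with action `α`,
leading to global state `s'`. -/
structure Algorithm (T I R : Type*) where
  State : Type*
  init : State
  Step : State → T → StepAction I R → State → Prop

namespace Algorithm

variable {T I R : Type*}

/-- A step of an execution, with the state it leads to. -/
abbrev ExecStep (A : Algorithm T I R) : Type _ := T × StepAction I R × A.State

def IsPath (A : Algorithm T I R) : A.State → List A.ExecStep → Prop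
  | _, [] => True
  | s, (t, α, s') :: σ => A.Step s t α s' ∧ A.IsPath s' σ

/-- A finite execution: an alternating sequence of states and steps that starts in the initial
state (which is not recorded). -/
def IsExecution (A : Algorithm T I R) (σ : List A.ExecStep) : Prop :=
  A.IsPath A.init σ

end Algorithm

/-- An element of a history: an invoke or a response step of a thread. -/
inductive Event (T I R : Type*) where
  | inv (t : T) (i : I)
  | res (t : T) (r : R)

def Event.thread {T I R : Type*} : Event T I R → T
  | .inv t _ => t
  | .res t _ => t

def StepAction.event? {T I R : Type*} (t : T) : StepAction I R → Option (Event T I R)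
  | .inv i => some (.inv t i)
  | .res r => some (.res t r)
  | .tau => none

/-- The history of an execution: its subsequence of invoke and response steps. -/
def Algorithm.history {T I R : Type*} (A : Algorithm T I R) (σ : List A.ExecStep) :
    List (Event T I R) :=
  σ.filterMap fun e => e.2.1.event? e.1

/-- An invocation together with its response, by thread `thread`. The number `id` tells different
calls apart; in a linearisation of a history `h` it is the position in `h` of the invocation. -/
structure Call (T I R : Type*) where
  id : ℕ
  thread : T
  inv : I
  res : R

/-- A sequential history: each invocation is immediately followed by its response, so that it is
a list of calls. -/
abbrev SeqHistory (T I R : Type*) : Type _ := List (Call T I R)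

/-- In the history `h`, the operation invoked by thread `t` at position `p` gets its response `r`
at position `q`. -/
def RespondsAt {T I R : Type*} (h : List (Event T I R)) (p q : ℕ) (t : T) (r : R) : Prop :=
  (∃ i, h[p]? = some (.inv t i)) ∧ h[q]? = some (.res t r) ∧ p < q ∧
    ∀ m e, p < m → m < q → h[m]? = some e → e.thread ≠ t

/-- In the history `h`, the operation invoked at position `p` gets its response before the
invocation at position `p'`. -/
def PrecedesInTime {T I R : Type*} (h : List (Event T I R)) (p p' : ℕ) : Prop :=
  ∃ q t r, RespondsAt h p q t r ∧ q < p'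

/-- `H` arises from the concurrent history `h` by adding responses to some pending invocations,
removing the other pending invocations, and ordering the resulting calls sequentially in a way
that preserves the order between non-overlapping operations. -/
structure IsSerialisation {T I R : Type*} (h : List (Event T I R)) (H : SeqHistory T I R) :
    Prop where
  nodup : (H.map Call.id).Nodup
  invoked : ∀ c ∈ H, h[c.id]? = some (.inv c.thread c.inv)
  completed : ∀ p q t r, RespondsAt h p q t r → ∃ c ∈ H, c.id = p ∧ c.res = r
  order : H.Pairwise fun c c' => ¬ PrecedesInTime h c'.id c.id

/-- Strong linearisability with respect to a set of sequential histories: there is a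
prefix-preserving function that maps every execution to one of its linearisations. -/
def StronglyLinearisable {T I R : Type*} (A : Algorithm T I R) (Spec : Set (SeqHistory T I R)) :
    Prop :=
  ∃ f : List A.ExecStep → SeqHistory T I R,
    (∀ σ σ', A.IsExecution σ → A.IsExecution σ' → σ <+: σ' → f σ <+: f σ') ∧
    ∀ σ, A.IsExecution σ → f σ ∈ Spec ∧ IsSerialisation (A.history σ) (f σ)

/-! ## Relaxation -/

/-- `H` is an `r`-relaxation of `H'`: it consists of all but at most `r` of the calls of `H'` (`φ`
sends each call of `H` to the same call in `H'`), and each call of `H` is preceded in `H` by all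
but at most `r` of the calls that precede it in `H'`. -/
def IsRelaxation {T I R : Type*} (r : ℕ) (H H' : SeqHistory T I R) : Prop :=
  ∃ φ : Fin H.length → Fin H'.length, Function.Injective φ ∧
    (∀ k, H[k] = H'[φ k]) ∧
    H'.length ≤ H.length + r ∧
    ∀ k, {j : Fin H'.length | j < φ k ∧ ∀ i, i < k → φ i ≠ j}.ncard ≤ r

/-- The `r`-relaxation of a sequential specification. -/
def Relaxed {T I R : Type*} (Spec : Set (SeqHistory T I R)) (r : ℕ) : Set (SeqHistory T I R) :=
  {H' | ∃ H ∈ Spec, IsRelaxation r H H'}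

/-! ## Sequential sketches -/

/-- The sequential methods of a (derandomised) sketch with stream elements `Elem`, query
arguments `Arg`, query results `Val` and hints `Hint`. The oracle's output is fixed: a random
choice made at initialisation is part of `empty`, and a coin flip supplied with an update is part
of the element. -/
structure SketchMethods (Elem Arg Val Hint : Type*) where
  State : Type*
  empty : State
  update : State → Elem → State
  query : State → Arg → Val
  merge : State → State → State
  calcHint : State → Hint
  shouldAdd : Hint → Elem → Bool

/-- The state `s` summarises the stream `A`: it is the state of a sketch that has processed `A`. -/
def SketchMethods.Summarises {Elem Arg Val Hint : Type*} (S : SketchMethods Elem Arg Val Hint)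
    (s : S.State) (A : List Elem) : Prop :=
  s = A.foldl S.update S.empty

inductive SketchInv (Elem Arg : Type*) where
  | update (a : Elem)
  | query (x : Arg)

inductive SketchRes (Val : Type*) where
  | ack
  | value (v : Val)

/-- The sequential history is the one of a sequential execution from state `s`. -/
def SketchMethods.SeqRun {Elem Arg Val Hint : Type*} (S : SketchMethods Elem Arg Val Hint)
    {T : Type*} : S.State → SeqHistory T (SketchInv Elem Arg) (SketchRes Val) → Prop
  | _, [] => True
  | s, c :: H =>
    match c.inv with
    | .update a => c.res = .ack ∧ S.SeqRun (S.update s a) H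
    | .query x => c.res = .value (S.query s x) ∧ S.SeqRun s H

/-- The histories of updates and queries that arise in sequential executions of the sketch. -/
def SeqSketch {Elem Arg Val Hint : Type*} (S : SketchMethods Elem Arg Val Hint) (T : Type*) :
    Set (SeqHistory T (SketchInv Elem Arg) (SketchRes Val)) :=
  {H | S.SeqRun S.empty H}

/-! ## Composable sketches -/

/-- An implementation of a shared object in which every thread runs a deterministic state machine
(with local states `Loc`) over a shared memory `Mem`: `start t i` is the local state of thread `t`
right after it invokes `i`, and each later step transforms the memory atomically and either moves
to a new local state or ends the operation with a response. -/
structure SharedObject.{w, u, v, x} (T : Type u) (I : Type v) (R : Type x) where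
  Mem : Type w
  Loc : Type w
  mem : Mem
  start : T → I → Loc
  next : T → Mem → Loc → Mem × (Loc ⊕ R)

namespace SharedObject

variable {T I R : Type*} [DecidableEq T]

/-- The shared memory, and for each thread the local state of its operation in progress. -/
abbrev Config (O : SharedObject T I R) : Type _ := O.Mem × (T → Option O.Loc)

inductive Step (O : SharedObject T I R) (allowed : T → I → Prop) :
    O.Config → T → StepAction I R → O.Config → Prop
  | invoke (m : O.Mem) (p : T → Option O.Loc) (t : T) (i : I) :
      allowed t i → p t = none →
      Step O allowed (m, p) t (.inv i) (m, Function.update p t (some (O.start t i)))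
  | internal (m m' : O.Mem) (p : T → Option O.Loc) (t : T) (l l' : O.Loc) :
      p t = some l → O.next t m l = (m', Sum.inl l') →
      Step O allowed (m, p) t .tau (m', Function.update p t (some l'))
  | respond (m m' : O.Mem) (p : T → Option O.Loc) (t : T) (l : O.Loc) (r : R) :
      p t = some l → O.next t m l = (m', Sum.inr r) →
      Step O allowed (m, p) t (.res r) (m', Function.update p t none)

/-- The executions of the object in which thread `t` invokes only operations `i` with
`allowed t i`, one at a time. -/
def toAlgorithm (O : SharedObject T I R) (allowed : T → I → Prop) : Algorithm T I R where
  State := O.Config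
  init := (O.mem, fun _ => none)
  Step := O.Step allowed

end SharedObject

/-- The threads that access the global sketch: the propagator and the query threads `Q`. -/
inductive GlobalThread (Q : Type*) where
  | propagator
  | query (j : Q)
deriving DecidableEq

inductive GlobalInv (σ : Type*) where
  | merge (s : σ)
  | calcHint
  | snapshot

inductive GlobalRes (σ Hint : Type*) where
  | ack
  | hint (h : Hint)
  | copy (s : σ)

/-- Sequential specification of `merge`, `calcHint` and `snapshot`, from state `s`; a snapshot may
return any copy that answers all queries as the current state does. -/
def SketchMethods.GlobalRun {Elem Arg Val Hint : Type*} (S : SketchMethods Elem Arg Val Hint)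
    {T : Type*} : S.State → SeqHistory T (GlobalInv S.State) (GlobalRes S.State Hint) → Prop
  | _, [] => True
  | s, c :: H =>
    match c.inv with
    | .merge s' => c.res = .ack ∧ S.GlobalRun (S.merge s s') H
    | .calcHint => c.res = .hint (S.calcHint s) ∧ S.GlobalRun s H
    | .snapshot =>
        (∃ s', c.res = .copy s' ∧ ∀ x, S.query s' x = S.query s x) ∧ S.GlobalRun s H

/-- The concurrency that a composable sketch has to support: one thread, the propagator, merges
sketches into the shared one and computes hints, while other threads take snapshots. -/
def SketchMethods.GlobalAllowed {Elem Arg Val Hint : Type*} (S : SketchMethods Elem Arg Val Hint)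
    {Q : Type*} : GlobalThread Q → GlobalInv S.State → Prop
  | .propagator, .merge s => ∃ A, S.Summarises s A
  | .propagator, .calcHint => True
  | .query _, .snapshot => True
  | _, _ => False

/-- A composable sketch, shared with a set `Q` of query threads. -/
structure ComposableSketch.{w, y, u₁, u₂, u₃, u₄, u₅} (Elem : Type u₁) (Arg : Type u₂)
    (Val : Type u₃) (Hint : Type u₄) (Q : Type u₅) [Zero Hint] [One Hint] [DecidableEq Q]
    extends SketchMethods.{u₁, u₂, u₃, u₄, y} Elem Arg Val Hint where
  merge_summarises : ∀ s s' A A', toSketchMethods.Summarises s A →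
    toSketchMethods.Summarises s' A' → toSketchMethods.Summarises (merge s s') (A ++ A')
  calcHint_ne_zero : ∀ s A, toSketchMethods.Summarises s A → calcHint s ≠ 0
  shouldAdd_calcHint : ∀ s A a, toSketchMethods.Summarises s A →
    shouldAdd (calcHint s) a = false → ∀ B₁ B₂ s',
    toSketchMethods.Summarises s' (A ++ B₁ ++ [a] ++ B₂) →
    toSketchMethods.Summarises s' (A ++ B₁ ++ B₂)
  /-- The initial hint `1` of the update threads is a correct hint for the empty sketch. -/
  shouldAdd_one : ∀ a, shouldAdd 1 a = false → ∀ B₁ B₂ s',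
    toSketchMethods.Summarises s' (B₁ ++ [a] ++ B₂) → toSketchMethods.Summarises s' (B₁ ++ B₂)
  /-- The implementation of the shared sketch, initially empty. -/
  shared : SharedObject.{w} (GlobalThread Q) (GlobalInv State) (GlobalRes State Hint)
  shared_stronglyLinearisable :
    StronglyLinearisable (shared.toAlgorithm toSketchMethods.GlobalAllowed)
      {H | toSketchMethods.GlobalRun empty H}

/-! ## The double-buffered concurrent algorithm -/

/-- `N` update threads, the propagator, and the query threads. -/
inductive OptThread (N : ℕ) (Q : Type*) where
  | update (i : Fin N)
  | propagator
  | query (j : Q)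

/-- Program counter of an update thread: the statement it executes next. -/
inductive UpdatePC (Elem : Type*) where
  | idle
  | shouldAdd (a : Elem)
  | incCounter (a : Elem)
  | updateLocal (a : Elem)
  | checkFull
  | wait
  | swap
  | updateHint
  | zeroCounter
  | signal
  | respond

/-- Program counter of the propagator; `merging` and `calculating` mean that the call of `merge`
or `calcHint` on the global sketch is in progress. -/
inductive PropagatorPC (N : ℕ) (Hint : Type*) where
  | scan
  | merge (i : Fin N)
  | merging (i : Fin N)
  | emptyLocal (i : Fin N)
  | calcHint (i : Fin N)
  | calculating (i : Fin N)
  | setProp (i : Fin N) (h : Hint)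

/-- Program counter of a query thread. -/
inductive QueryPC (Arg σ : Type*) where
  | idle
  | snapshot (x : Arg)
  | snapshotting (x : Arg)
  | respond (x : Arg) (localCopy : σ)

section OptParSketch

variable {Elem Arg Val Hint Q : Type*} [Zero Hint] [One Hint] [DecidableEq Q]

/-- The two local sketches of thread `i` are `localS i false` and `localS i true`, the one that
it currently works on is `localS i (cur i)`, and the auxiliary one is `localS i (!cur i)`. -/
structure OptState (S : ComposableSketch Elem Arg Val Hint Q) (N : ℕ) where
  globalS : S.shared.Config
  localS : Fin N → Bool → S.State
  cur : Fin N → Bool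
  counter : Fin N → ℕ
  hint : Fin N → Hint
  prop : Fin N → Hint
  updatePC : Fin N → UpdatePC Elem
  propagatorPC : PropagatorPC N Hint
  queryPC : Q → QueryPC Arg S.State

def OptState.init (S : ComposableSketch Elem Arg Val Hint Q) (N : ℕ) : OptState S N where
  globalS := (S.shared.mem, fun _ => none)
  localS := fun _ _ => S.empty
  cur := fun _ => false
  counter := fun _ => 0
  hint := fun _ => 1
  prop := fun _ => 1
  updatePC := fun _ => .idle
  propagatorPC := .scan
  queryPC := fun _ => .idle

/-- Set the program counter of update thread `i`. -/
def OptState.gotoU {S : ComposableSketch Elem Arg Val Hint Q} {N : ℕ} (s : OptState S N)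
    (i : Fin N) (pc : UpdatePC Elem) : OptState S N :=
  { s with updatePC := Function.update s.updatePC i pc }

/-- Set the program counter of query thread `j`. -/
def OptState.gotoQ {S : ComposableSketch Elem Arg Val Hint Q} {N : ℕ} (s : OptState S N)
    (j : Q) (pc : QueryPC Arg S.State) : OptState S N :=
  { s with queryPC := Function.update s.queryPC j pc }

/-- Assign to one of the two local sketches of update thread `i`. -/
def OptState.setLocal {S : ComposableSketch Elem Arg Val Hint Q} {N : ℕ} (s : OptState S N)
    (i : Fin N) (k : Bool) (x : S.State) : OptState S N :=
  { s with localS := Function.update s.localS i (Function.update (s.localS i) k x) }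

/-- One step of the implementation of the global sketch. -/
abbrev ComposableSketch.SharedStep (S : ComposableSketch Elem Arg Val Hint Q)
    (g : S.shared.Config) (t : GlobalThread Q)
    (α : StepAction (GlobalInv S.State) (GlobalRes S.State Hint)) (g' : S.shared.Config) : Prop :=
  S.shared.Step (fun _ _ => True) g t α g'

/-- The steps of the double-buffered algorithm with buffer size `b`. -/
inductive OptStep (S : ComposableSketch Elem Arg Val Hint Q) (N b : ℕ) :
    OptState S N → OptThread N Q → StepAction (SketchInv Elem Arg) (SketchRes Val) →
    OptState S N → Prop
  -- update threads
  | u_invoke (s : OptState S N) (i : Fin N) (a : Elem) : s.updatePC i = .idle →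
      OptStep S N b s (.update i) (.inv (.update a)) (s.gotoU i (.shouldAdd a))
  | u_filter (s : OptState S N) (i : Fin N) (a : Elem) : s.updatePC i = .shouldAdd a →
      S.shouldAdd (s.hint i) a = false →
      OptStep S N b s (.update i) .tau (s.gotoU i .respond)
  | u_add (s : OptState S N) (i : Fin N) (a : Elem) : s.updatePC i = .shouldAdd a →
      S.shouldAdd (s.hint i) a = true →
      OptStep S N b s (.update i) .tau (s.gotoU i (.incCounter a))
  | u_incCounter (s : OptState S N) (i : Fin N) (a : Elem) : s.updatePC i = .incCounter a →
      OptStep S N b s (.update i) .tau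
        ({ s with counter := Function.update s.counter i (s.counter i + 1) }.gotoU i
          (.updateLocal a))
  | u_updateLocal (s : OptState S N) (i : Fin N) (a : Elem) : s.updatePC i = .updateLocal a →
      OptStep S N b s (.update i) .tau
        ((s.setLocal i (s.cur i) (S.update (s.localS i (s.cur i)) a)).gotoU i .checkFull)
  | u_notFull (s : OptState S N) (i : Fin N) : s.updatePC i = .checkFull → s.counter i ≠ b →
      OptStep S N b s (.update i) .tau (s.gotoU i .respond)
  | u_full (s : OptState S N) (i : Fin N) : s.updatePC i = .checkFull → s.counter i = b →
      OptStep S N b s (.update i) .tau (s.gotoU i .wait)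
  | u_wait (s : OptState S N) (i : Fin N) : s.updatePC i = .wait → s.prop i ≠ 0 →
      OptStep S N b s (.update i) .tau (s.gotoU i .swap)
  | u_swap (s : OptState S N) (i : Fin N) : s.updatePC i = .swap →
      OptStep S N b s (.update i) .tau
        ({ s with cur := Function.update s.cur i (!s.cur i) }.gotoU i .updateHint)
  | u_updateHint (s : OptState S N) (i : Fin N) : s.updatePC i = .updateHint →
      OptStep S N b s (.update i) .tau
        ({ s with hint := Function.update s.hint i (s.prop i) }.gotoU i .zeroCounter)
  | u_zeroCounter (s : OptState S N) (i : Fin N) : s.updatePC i = .zeroCounter →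
      OptStep S N b s (.update i) .tau
        ({ s with counter := Function.update s.counter i 0 }.gotoU i .signal)
  | u_signal (s : OptState S N) (i : Fin N) : s.updatePC i = .signal →
      OptStep S N b s (.update i) .tau
        ({ s with prop := Function.update s.prop i 0 }.gotoU i .respond)
  | u_respond (s : OptState S N) (i : Fin N) : s.updatePC i = .respond →
      OptStep S N b s (.update i) (.res .ack) (s.gotoU i .idle)
  -- propagator
  | p_select (s : OptState S N) (i : Fin N) : s.propagatorPC = .scan → s.prop i = 0 →
      OptStep S N b s .propagator .tau { s with propagatorPC := .merge i }
  | p_merge (s : OptState S N) (i : Fin N) (g : S.shared.Config) : s.propagatorPC = .merge i →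
      S.SharedStep s.globalS .propagator (.inv (.merge (s.localS i (!s.cur i)))) g →
      OptStep S N b s .propagator .tau { s with globalS := g, propagatorPC := .merging i }
  | p_merging (s : OptState S N) (i : Fin N) (g : S.shared.Config) :
      s.propagatorPC = .merging i → S.SharedStep s.globalS .propagator .tau g →
      OptStep S N b s .propagator .tau { s with globalS := g }
  | p_merged (s : OptState S N) (i : Fin N) (g : S.shared.Config)
      (r : GlobalRes S.State Hint) :
      s.propagatorPC = .merging i → S.SharedStep s.globalS .propagator (.res r) g →
      OptStep S N b s .propagator .tau { s with globalS := g, propagatorPC := .emptyLocal i }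
  | p_emptyLocal (s : OptState S N) (i : Fin N) : s.propagatorPC = .emptyLocal i →
      OptStep S N b s .propagator .tau
        { s.setLocal i (!s.cur i) S.empty with propagatorPC := .calcHint i }
  | p_calcHint (s : OptState S N) (i : Fin N) (g : S.shared.Config) :
      s.propagatorPC = .calcHint i → S.SharedStep s.globalS .propagator (.inv .calcHint) g →
      OptStep S N b s .propagator .tau { s with globalS := g, propagatorPC := .calculating i }
  | p_calculating (s : OptState S N) (i : Fin N) (g : S.shared.Config) :
      s.propagatorPC = .calculating i → S.SharedStep s.globalS .propagator .tau g →
      OptStep S N b s .propagator .tau { s with globalS := g }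
  | p_calculated (s : OptState S N) (i : Fin N) (g : S.shared.Config) (h : Hint) :
      s.propagatorPC = .calculating i → S.SharedStep s.globalS .propagator (.res (.hint h)) g →
      OptStep S N b s .propagator .tau { s with globalS := g, propagatorPC := .setProp i h }
  | p_setProp (s : OptState S N) (i : Fin N) (h : Hint) : s.propagatorPC = .setProp i h →
      OptStep S N b s .propagator .tau
        { s with prop := Function.update s.prop i h, propagatorPC := .scan }
  -- query threads
  | q_invoke (s : OptState S N) (j : Q) (x : Arg) : s.queryPC j = .idle →
      OptStep S N b s (.query j) (.inv (.query x)) (s.gotoQ j (.snapshot x))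
  | q_snapshot (s : OptState S N) (j : Q) (x : Arg) (g : S.shared.Config) :
      s.queryPC j = .snapshot x → S.SharedStep s.globalS (.query j) (.inv .snapshot) g →
      OptStep S N b s (.query j) .tau ({ s with globalS := g }.gotoQ j (.snapshotting x))
  | q_snapshotting (s : OptState S N) (j : Q) (x : Arg) (g : S.shared.Config) :
      s.queryPC j = .snapshotting x → S.SharedStep s.globalS (.query j) .tau g →
      OptStep S N b s (.query j) .tau { s with globalS := g }
  | q_copied (s : OptState S N) (j : Q) (x : Arg) (g : S.shared.Config) (localCopy : S.State) :
      s.queryPC j = .snapshotting x →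
      S.SharedStep s.globalS (.query j) (.res (.copy localCopy)) g →
      OptStep S N b s (.query j) .tau ({ s with globalS := g }.gotoQ j (.respond x localCopy))
  | q_respond (s : OptState S N) (j : Q) (x : Arg) (localCopy : S.State) :
      s.queryPC j = .respond x localCopy →
      OptStep S N b s (.query j) (.res (.value (S.query localCopy x))) (s.gotoQ j .idle)

/-- The double-buffered generic concurrent sketch algorithm with `N` update threads and buffer
size `b`, instantiated with the composable sketch `S`. -/
def OptParSketch (S : ComposableSketch Elem Arg Val Hint Q) (N b : ℕ) :
    Algorithm (OptThread N Q) (SketchInv Elem Arg) (SketchRes Val) where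
  State := OptState S N
  init := OptState.init S N
  Step := OptStep S N b

end OptParSketch

/-!
Strong linearisability amounts to a forward simulation that, in each step, may only append calls
to the linearisation. In `OptParSketch` an update takes effect when its element enters the local
sketch, or when it is filtered out, and a query takes effect together with its snapshot. Queries
do not see all of these calls: an update becomes visible at once if it is filtered out, because
then it does not change the summary, and otherwise only when the merge of its buffer takes effect
on the global sketch. The sequence of visible calls is thus a run of the sequential sketch. Each of
the `N` update threads has two buffers with at most `b` updates, so at most `2 * N * b` linearised
calls are not visible at any time. Hence a call that becomes visible is preceded in the
linearisation by at most `2 * N * b` calls that were not visible before it, which makes the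
visible history a relaxation of the linearised one.
-/

namespace Algorithm

variable {T I R : Type*}

/-- The state that a path `σ` from `s` leads to. -/
def endState (A : Algorithm T I R) (s : A.State) (σ : List A.ExecStep) : A.State :=
  σ.foldl (fun _ e => e.2.2) s

theorem endState_concat (A : Algorithm T I R) (s : A.State) (σ : List A.ExecStep)
    (e : A.ExecStep) : A.endState s (σ ++ [e]) = e.2.2 := by
  simp [endState]

theorem isPath_concat (A : Algorithm T I R) (s : A.State) (σ : List A.ExecStep)
    (e : A.ExecStep) :
    A.IsPath s (σ ++ [e]) ↔ A.IsPath s σ ∧ A.Step (A.endState s σ) e.1 e.2.1 e.2.2 := by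
  induction σ generalizing s with
  | nil => simp [IsPath, endState]
  | cons e' σ ih => simp [IsPath, endState, ih, and_assoc]

theorem history_concat (A : Algorithm T I R) (σ : List A.ExecStep) (e : A.ExecStep) :
    A.history (σ ++ [e]) = A.history σ ++ (e.2.1.event? e.1).toList := by
  cases h : e.2.1.event? e.1 <;> simp [history, h]

end Algorithm

section ForwardSimulation

variable {T I R : Type*}

/-- Relations between the states that `A` reaches, the histories with which it reaches them, and
linearisations of these histories. -/
abbrev SimRel (A : Algorithm T I R) : Type _ :=
  A.State → List (Event T I R) → SeqHistory T I R → Prop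

/-- `Sim s h H` relates a state `s` reached with history `h` to a linearisation `H` of `h`; every
step of `A` can be matched by appending calls to `H`, so that nothing linearised is ever
reconsidered. -/
structure IsForwardSimulation (A : Algorithm T I R) (Spec : Set (SeqHistory T I R))
    (Sim : SimRel A) : Prop where
  init : Sim A.init [] []
  step : ∀ {s t α s' h H}, A.Step s t α s' → Sim s h H →
    ∃ H', H <+: H' ∧ Sim s' (h ++ (α.event? t).toList) H'
  sound : ∀ {s h H}, Sim s h H → H ∈ Spec ∧ IsSerialisation h H

theorem IsSerialisation.eq_nil {H : SeqHistory T I R} (hH : IsSerialisation [] H) : H = [] :=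
  List.eq_nil_iff_forall_not_mem.2 fun c hc => by simpa using hH.invoked c hc

theorem StronglyLinearisable.exists_isForwardSimulation {A : Algorithm T I R}
    {Spec : Set (SeqHistory T I R)} (hA : StronglyLinearisable A Spec) :
    ∃ Sim, IsForwardSimulation A Spec Sim := by
  obtain ⟨f, hmono, hlin⟩ := hA
  refine ⟨fun s h H => ∃ σ, A.IsExecution σ ∧ A.endState A.init σ = s ∧ A.history σ = h ∧ f σ = H,
    ⟨[], trivial, rfl, rfl, (hlin [] trivial).2.eq_nil⟩, ?_, ?_⟩
  · rintro _ t α s' _ _ hstep ⟨σ, hσ, rfl, rfl, rfl⟩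
    have hσ' : A.IsExecution (σ ++ [(t, α, s')]) := (A.isPath_concat _ _ _).2 ⟨hσ, hstep⟩
    exact ⟨_, hmono _ _ hσ hσ' (List.prefix_append _ _),
      _, hσ', A.endState_concat _ _ _, A.history_concat _ _, rfl⟩
  · rintro _ _ _ ⟨σ, hσ, -, rfl, rfl⟩
    exact hlin σ hσ

theorem IsForwardSimulation.stronglyLinearisable {A : Algorithm T I R}
    {Spec : Set (SeqHistory T I R)} {Sim : SimRel A}
    (hSim : IsForwardSimulation A Spec Sim) : StronglyLinearisable A Spec := by
  have hnext : ∀ σ e H, ∃ H', H <+: H' ∧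
      (A.IsExecution (σ ++ [e]) → Sim (A.endState A.init σ) (A.history σ) H →
        Sim (A.endState A.init (σ ++ [e])) (A.history (σ ++ [e])) H') := by
    intro σ e H
    by_cases h : A.IsExecution (σ ++ [e]) ∧ Sim (A.endState A.init σ) (A.history σ) H
    · obtain ⟨H', hpre, hH'⟩ := hSim.step ((A.isPath_concat _ _ _).1 h.1).2 h.2
      exact ⟨H', hpre, fun _ _ => by rwa [A.endState_concat, A.history_concat]⟩
    · exact ⟨H, List.prefix_rfl, fun h₁ h₂ => absurd ⟨h₁, h₂⟩ h⟩
  choose next hmono hnext using hnext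
  let f (σ : List A.ExecStep) : SeqHistory T I R := σ.reverseRecOn [] next
  have hf (σ) (e) : f (σ ++ [e]) = next σ e (f σ) := List.reverseRecOn_concat e σ [] next
  refine ⟨f, ?_, fun σ hσ => hSim.sound (s := A.endState A.init σ) ?_⟩
  · rintro σ _ - - ⟨κ, rfl⟩
    induction κ using List.reverseRecOn with
    | nil => rw [List.append_nil]
    | append_singleton κ e ih =>
      rw [← List.append_assoc, hf]
      exact ih.trans (hmono _ _ _)
  · induction σ using List.reverseRecOn with
    | nil =>
      have hf₀ : f [] = [] := List.reverseRecOn_nil [] next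
      exact hf₀ ▸ hSim.init
    | append_singleton σ e ih =>
      rw [hf]
      exact hnext _ _ _ hσ (ih ((A.isPath_concat _ _ _).1 hσ).1)

end ForwardSimulation

section Linearisation

variable {T I R : Type*}

theorem getElem?_append_singleton_eq_some_iff {α : Type*} {l : List α} {a b : α} {n : ℕ} :
    (l ++ [a])[n]? = some b ↔ l[n]? = some b ∨ n = l.length ∧ a = b := by
  rcases lt_trichotomy n l.length with hn | rfl | hn
  · simp [List.getElem?_append_left hn, hn.ne]
  · simp
  · have hlen : (l ++ [a]).length ≤ n := by simpa using hn
    simp [List.getElem?_eq_none hlen, hn.le, hn.ne']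

/-- The operation `i` that thread `t` invoked at position `p` of the history `h` is pending. -/
def OpenAt (h : List (Event T I R)) (p : ℕ) (t : T) (i : I) : Prop :=
  h[p]? = some (.inv t i) ∧ ∀ m e, p < m → h[m]? = some e → e.thread ≠ t

/-- Every operation that is invoked in `h` is pending or has got its response. This fails if a
thread invokes an operation while another one of its operations is pending. -/
def IsWellFormed (h : List (Event T I R)) : Prop :=
  ∀ p t i, h[p]? = some (.inv t i) → OpenAt h p t i ∨ ∃ q r, RespondsAt h p q t r

theorem openAt_concat {h : List (Event T I R)} {e : Event T I R} {p : ℕ} {t : T} {i : I} :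
    OpenAt (h ++ [e]) p t i ↔ OpenAt h p t i ∧ e.thread ≠ t ∨ p = h.length ∧ e = .inv t i := by
  simp only [OpenAt, getElem?_append_singleton_eq_some_iff]
  constructor
  · rintro ⟨hp | hp, hlast⟩
    · have hlt := (List.getElem?_eq_some_iff.1 hp).1
      exact .inl ⟨⟨hp, fun m e' hm he' => hlast m e' hm (.inl he')⟩,
        hlast _ _ hlt (.inr ⟨rfl, rfl⟩)⟩
    · exact .inr hp
  · rintro (⟨⟨hp, hlast⟩, he⟩ | ⟨rfl, rfl⟩)
    · refine ⟨.inl hp, ?_⟩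
      rintro m e' hm (he' | ⟨-, rfl⟩)
      exacts [hlast m e' hm he', he]
    · refine ⟨.inr ⟨rfl, rfl⟩, ?_⟩
      rintro m e' hm (he' | ⟨rfl, -⟩)
      exacts [absurd (List.getElem?_eq_some_iff.1 he').1 hm.not_gt, absurd hm (lt_irrefl _)]

theorem respondsAt_concat {h : List (Event T I R)} {e : Event T I R} {p q : ℕ} {t : T} {r : R} :
    RespondsAt (h ++ [e]) p q t r ↔
      RespondsAt h p q t r ∨ q = h.length ∧ e = .res t r ∧ ∃ i, OpenAt h p t i := by
  simp only [RespondsAt, OpenAt, getElem?_append_singleton_eq_some_iff]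
  constructor
  · rintro ⟨⟨i, hi⟩, hq, hpq, hm⟩
    have hp : h[p]? = some (.inv t i) := by
      refine hi.resolve_right ?_
      rintro ⟨rfl, -⟩
      rcases hq with hq | ⟨rfl, -⟩
      exacts [hpq.not_gt (List.getElem?_eq_some_iff.1 hq).1, hpq.ne rfl]
    rcases hq with hq | ⟨rfl, rfl⟩
    · exact .inl ⟨⟨i, hp⟩, hq, hpq, fun m e' h₁ h₂ h₃ => hm m e' h₁ h₂ (.inl h₃)⟩
    · exact .inr ⟨rfl, rfl, i, hp, fun m e' h₁ h₃ =>
        hm m e' h₁ (List.getElem?_eq_some_iff.1 h₃).1 (.inl h₃)⟩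
  · rintro (⟨⟨i, hi⟩, hq, hpq, hm⟩ | ⟨rfl, rfl, i, hi, hm⟩)
    · refine ⟨⟨i, .inl hi⟩, .inl hq, hpq, ?_⟩
      rintro m e' h₁ h₂ (h₃ | ⟨rfl, -⟩)
      exacts [hm m e' h₁ h₂ h₃, absurd (List.getElem?_eq_some_iff.1 hq).1 h₂.not_gt]
    · refine ⟨⟨i, .inl hi⟩, .inr ⟨rfl, rfl⟩, (List.getElem?_eq_some_iff.1 hi).1, ?_⟩
      rintro m e' h₁ h₂ (h₃ | ⟨rfl, -⟩)
      exacts [hm m e' h₁ h₃, absurd h₂ (lt_irrefl _)]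

namespace OpenAt

variable {h : List (Event T I R)} {p p' q : ℕ} {t t' : T} {i i' : I} {r : R}

theorem not_respondsAt (ho : OpenAt h p t i) : ¬ RespondsAt h p q t' r := by
  rintro ⟨⟨i', hi⟩, hq, hpq, -⟩
  cases ho.1.symm.trans hi
  exact ho.2 q _ hpq hq rfl

theorem eq (ho : OpenAt h p t i) (ho' : OpenAt h p' t i') : p = p' ∧ i = i' := by
  have hp : p = p' := by
    rcases lt_trichotomy p p' with hlt | heq | hgt
    exacts [absurd rfl (ho.2 _ _ hlt ho'.1), heq, absurd rfl (ho'.2 _ _ hgt ho.1)]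
  subst hp
  cases ho.1.symm.trans ho'.1
  exact ⟨rfl, rfl⟩

end OpenAt

theorem IsWellFormed.concat {h : List (Event T I R)} (hh : IsWellFormed h) {e : Event T I R}
    (he : ∀ p i, OpenAt h p e.thread i → ∃ r, e = .res e.thread r) : IsWellFormed (h ++ [e]) := by
  intro p t i hp
  rw [openAt_concat]
  simp only [respondsAt_concat]
  rcases getElem?_append_singleton_eq_some_iff.1 hp with hp | hp
  · rcases hh p t i hp with ho | ⟨q, r, hr⟩
    · by_cases het : e.thread = t
      · subst het
        obtain ⟨r, hr⟩ := he p i ho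
        exact .inr ⟨_, r, .inr ⟨rfl, hr, i, ho⟩⟩
      · exact .inl (.inl ⟨ho, het⟩)
    · exact .inr ⟨q, r, .inl hr⟩
  · exact .inl (.inr hp)

namespace IsSerialisation

variable {h : List (Event T I R)} {H : SeqHistory T I R}

theorem concat_event (hH : IsSerialisation h H) {e : Event T I R}
    (he : ∀ p t i r, e = .res t r → OpenAt h p t i → ∃ c ∈ H, c.id = p ∧ c.res = r) :
    IsSerialisation (h ++ [e]) H where
  nodup := hH.nodup
  invoked c hc := getElem?_append_singleton_eq_some_iff.2 (.inl (hH.invoked c hc))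
  completed p q t r hr := by
    rcases respondsAt_concat.1 hr with hr | ⟨-, her, i, ho⟩
    exacts [hH.completed p q t r hr, he p t i r her ho]
  order := by
    refine hH.order.imp_of_mem ?_
    rintro c c' hc - hn ⟨q, t, r, hr, hq⟩
    have hlt := (List.getElem?_eq_some_iff.1 (hH.invoked c hc)).1
    refine hn ⟨q, t, r, (respondsAt_concat.1 hr).resolve_right ?_, hq⟩
    rintro ⟨rfl, -⟩
    exact hlt.not_gt hq

theorem of_concat_res {t : T} {r : R} (hH : IsSerialisation (h ++ [.res t r]) H) :
    IsSerialisation h H where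
  nodup := hH.nodup
  invoked c hc := (getElem?_append_singleton_eq_some_iff.1 (hH.invoked c hc)).resolve_right
    fun hc => nomatch hc.2
  completed p q t r hr := hH.completed p q t r (respondsAt_concat.2 (.inl hr))
  order := hH.order.imp fun hn ⟨q, t, r, hr, hq⟩ => hn ⟨q, t, r, respondsAt_concat.2 (.inl hr), hq⟩

theorem concat_call (hH : IsSerialisation h H) {c : Call T I R}
    (ho : OpenAt h c.id c.thread c.inv) (hc : ∀ c' ∈ H, c'.id ≠ c.id) :
    IsSerialisation h (H ++ [c]) where
  nodup := by
    rw [List.map_append, List.map_singleton, ← List.concat_eq_append]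
    exact List.nodup_concat _ _ |>.2 ⟨by simpa using hc, hH.nodup⟩
  invoked := by
    simp only [List.mem_append, List.mem_singleton]
    rintro c' (hc' | rfl)
    exacts [hH.invoked c' hc', ho.1]
  completed p q t r hr := by
    obtain ⟨c', hc', h₁⟩ := hH.completed p q t r hr
    exact ⟨c', List.mem_append_left _ hc', h₁⟩
  order := by
    refine List.pairwise_append.2 ⟨hH.order, List.pairwise_singleton _ _, ?_⟩
    simp only [List.mem_singleton]
    rintro c' - _ rfl ⟨q, t, r, hr, -⟩
    exact ho.not_respondsAt hr

end IsSerialisation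

/-- What a thread is doing: nothing, an operation that it invoked at position `p` and that has not
taken effect yet, or one that has taken effect with response `r`. -/
inductive OpStatus (I R : Type*) where
  | idle
  | pending (p : ℕ) (i : I)
  | done (p : ℕ) (i : I) (r : R)

/-- The status `o` of thread `t` agrees with the history `h` and its linearisation `H`; to take
effect is to be in `H`. -/
def OpStatus.Describes (h : List (Event T I R)) (H : SeqHistory T I R) (t : T) :
    OpStatus I R → Prop
  | .idle => ∀ p i, ¬ OpenAt h p t i
  | .pending p i => OpenAt h p t i ∧ ∀ c ∈ H, c.id ≠ p
  | .done p i r => OpenAt h p t i ∧ ⟨p, t, i, r⟩ ∈ H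

/-- The sequential history `H` linearises `h`, and `st` gives the statuses of the threads. -/
structure Linearises (h : List (Event T I R)) (st : T → OpStatus I R) (H : SeqHistory T I R) :
    Prop where
  isSerialisation : IsSerialisation h H
  isWellFormed : IsWellFormed h
  describes : ∀ t, (st t).Describes h H t

theorem OpStatus.Describes.concat_event {h : List (Event T I R)} {H : SeqHistory T I R} {t : T}
    {o : OpStatus I R} (ho : o.Describes h H t) {e : Event T I R} (he : e.thread ≠ t) :
    o.Describes (h ++ [e]) H t := by
  have hopen (p i) : OpenAt (h ++ [e]) p t i ↔ OpenAt h p t i := by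
    rw [openAt_concat, and_iff_left he, or_iff_left]
    rintro ⟨-, rfl⟩
    exact he rfl
  cases o <;> simpa only [Describes, hopen] using ho

theorem OpStatus.Describes.concat_call {h : List (Event T I R)} {H : SeqHistory T I R} {t : T}
    {o : OpStatus I R} (ho : o.Describes h H t) {c : Call T I R}
    (hc : OpenAt h c.id c.thread c.inv) (hct : c.thread ≠ t) : o.Describes h (H ++ [c]) t := by
  cases o with
  | idle => exact ho
  | pending p i =>
    refine ⟨ho.1, fun c' hc' => ?_⟩
    rcases List.mem_append.1 hc' with hc' | hc'
    · exact ho.2 c' hc'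
    · rintro rfl
      cases List.mem_singleton.1 hc'
      cases hc.1.symm.trans ho.1.1
      exact hct rfl
  | done p i r => exact ⟨ho.1, List.mem_append_left _ ho.2⟩

namespace Linearises

theorem nil : Linearises ([] : List (Event T I R)) (fun _ => .idle) [] where
  isSerialisation := ⟨by simp, by simp, fun p q t r hr => by simpa using hr.2.1, by simp⟩
  isWellFormed p t i hp := by simp at hp
  describes t p i ho := by simpa using ho.1

variable {h : List (Event T I R)} {st : T → OpStatus I R} {H : SeqHistory T I R}

theorem eq_pending (hl : Linearises h st H) {c : Call T I R}
    (hc : h[c.id]? = some (.inv c.thread c.inv)) (hn : ∀ c' ∈ H, c'.id ≠ c.id) :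
    st c.thread = .pending c.id c.inv := by
  have ho : OpenAt h c.id c.thread c.inv := by
    refine (hl.isWellFormed _ _ _ hc).resolve_right ?_
    rintro ⟨q, r, hr⟩
    obtain ⟨c', hc', hid, -⟩ := hl.isSerialisation.completed _ _ _ _ hr
    exact hn c' hc' hid
  have hd := hl.describes c.thread
  cases hst : st c.thread with rw [hst] at hd
  | idle => exact absurd ho (hd _ _)
  | pending p i =>
    obtain ⟨rfl, rfl⟩ := hd.1.eq ho
    rfl
  | done p i r =>
    obtain ⟨rfl, rfl⟩ := hd.1.eq ho
    exact (hn _ hd.2 rfl).elim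

theorem exists_eq_done (hl : Linearises h st H) {t : T} {r : R}
    (hH : IsSerialisation (h ++ [.res t r]) H) (ht : st t ≠ .idle) :
    ∃ p i, st t = .done p i r := by
  have hd := hl.describes t
  cases hst : st t with rw [hst] at hd
  | idle => exact absurd hst ht
  | pending p i =>
    obtain ⟨c, hc, hid, -⟩ :=
      hH.completed p _ t r (respondsAt_concat.2 (.inr ⟨rfl, rfl, i, hd.1⟩))
    exact absurd hid (hd.2 c hc)
  | done p i r' =>
    obtain ⟨c, hc, hid, rfl⟩ :=
      hH.completed p _ t r (respondsAt_concat.2 (.inr ⟨rfl, rfl, i, hd.1⟩))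
    obtain rfl := List.inj_on_of_nodup_map hH.nodup hc hd.2 hid
    exact ⟨p, i, rfl⟩

variable [DecidableEq T]

theorem invoke (hl : Linearises h st H) {t : T} (ht : st t = .idle) (i : I) :
    Linearises (h ++ [.inv t i]) (Function.update st t (.pending h.length i)) H where
  isSerialisation := hl.isSerialisation.concat_event (by simp)
  isWellFormed := hl.isWellFormed.concat fun p i' ho => by
    have hd := hl.describes t
    rw [ht] at hd
    exact absurd ho (hd p i')
  describes t' := by
    rcases eq_or_ne t' t with rfl | ht'
    · rw [Function.update_self]
      exact ⟨openAt_concat.2 (.inr ⟨rfl, rfl⟩),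
        fun c hc => (List.getElem?_eq_some_iff.1 (hl.isSerialisation.invoked c hc)).1.ne⟩
    · rw [Function.update_of_ne ht']
      exact (hl.describes t').concat_event ht'.symm

theorem linearise (hl : Linearises h st H) {c : Call T I R}
    (hc : st c.thread = .pending c.id c.inv) :
    Linearises h (Function.update st c.thread (.done c.id c.inv c.res)) (H ++ [c]) := by
  obtain ⟨ho, hn⟩ : OpenAt h c.id c.thread c.inv ∧ ∀ c' ∈ H, c'.id ≠ c.id := by
    have hd := hl.describes c.thread
    rwa [hc] at hd
  refine ⟨hl.isSerialisation.concat_call ho hn, hl.isWellFormed, fun t => ?_⟩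
  rcases eq_or_ne t c.thread with rfl | ht
  · rw [Function.update_self]
    exact ⟨ho, List.mem_append_right _ (List.mem_singleton_self c)⟩
  · rw [Function.update_of_ne ht]
    exact (hl.describes t).concat_call ho ht.symm

theorem respond (hl : Linearises h st H) {t : T} {p : ℕ} {i : I} {r : R}
    (ht : st t = .done p i r) :
    Linearises (h ++ [.res t r]) (Function.update st t .idle) H where
  isSerialisation := hl.isSerialisation.concat_event <| by
    rintro p' _ i' _ ⟨⟩ ho'
    have hd := hl.describes t
    rw [ht] at hd
    exact ⟨_, hd.2, (hd.1.eq ho').1, rfl⟩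
  isWellFormed := hl.isWellFormed.concat fun _ _ _ => ⟨r, rfl⟩
  describes t' := by
    rcases eq_or_ne t' t with rfl | ht'
    · rw [Function.update_self]
      intro p' i' ho'
      rcases openAt_concat.1 ho' with ⟨-, hne⟩ | ⟨-, heq⟩
      exacts [hne rfl, nomatch heq]
    · rw [Function.update_of_ne ht']
      exact (hl.describes t').concat_event ht'.symm

end Linearises

/-- The calls of `M` take effect one after the other; this changes the statuses of the threads
from `st` to `st'`. -/
inductive TakeEffect [DecidableEq T] :
    (T → OpStatus I R) → SeqHistory T I R → (T → OpStatus I R) → Prop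
  | nil (st) : TakeEffect st [] st
  | cons {st c M st'} : st c.thread = .pending c.id c.inv →
      TakeEffect (Function.update st c.thread (.done c.id c.inv c.res)) M st' →
      TakeEffect st (c :: M) st'

variable [DecidableEq T]

theorem TakeEffect.ne_idle {st st' : T → OpStatus I R} {M : SeqHistory T I R}
    (hM : TakeEffect st M st') {t : T} (ht : st t ≠ .idle) : st' t ≠ .idle := by
  induction hM with
  | nil => exact ht
  | @cons _ c _ _ _ _ ih =>
    apply ih
    rcases eq_or_ne t c.thread with rfl | ht'
    · simp
    · rwa [Function.update_of_ne ht']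

theorem Linearises.exists_takeEffect {h : List (Event T I R)} {st : T → OpStatus I R}
    {H M : SeqHistory T I R} (hl : Linearises h st H) (hHM : IsSerialisation h (H ++ M)) :
    ∃ st', TakeEffect st M st' ∧ Linearises h st' (H ++ M) := by
  induction M generalizing H st with
  | nil => exact ⟨st, .nil st, by rwa [List.append_nil]⟩
  | cons c M ih =>
    have hn : ∀ c' ∈ H, c'.id ≠ c.id := by
      intro c' hc'
      have hnodup := hHM.nodup
      rw [List.map_append, List.map_cons] at hnodup
      exact (List.nodup_append.1 hnodup).2.2 _ (List.mem_map_of_mem hc') _ List.mem_cons_self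
    have hc := hl.eq_pending (hHM.invoked c (by simp)) hn
    obtain ⟨st', hM, hl'⟩ := ih (hl.linearise hc) (by simpa using hHM)
    exact ⟨st', .cons hc hM, by simpa using hl'⟩

end Linearisation

section Tracking

variable {T I R : Type*} {A : Algorithm T I R} {Spec : Set (SeqHistory T I R)}
  {Sim : SimRel A}

/-- The state `s` can be reached in such a way that `L` is the linearisation and `st` gives the
statuses of the threads; the history is not recorded. -/
def Tracks (Sim : SimRel A) (s : A.State) (st : T → OpStatus I R)
    (L : SeqHistory T I R) : Prop :=
  ∃ h, Sim s h L ∧ Linearises h st L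

namespace IsForwardSimulation

theorem tracks_init (hSim : IsForwardSimulation A Spec Sim) :
    Tracks Sim A.init (fun _ => .idle) [] :=
  ⟨[], hSim.init, .nil⟩

theorem mem_of_tracks (hSim : IsForwardSimulation A Spec Sim) {s : A.State}
    {st : T → OpStatus I R} {L : SeqHistory T I R} (hs : Tracks Sim s st L) : L ∈ Spec := by
  obtain ⟨h, hs, -⟩ := hs
  exact (hSim.sound hs).1

variable [DecidableEq T] {s s' : A.State} {t : T} {st : T → OpStatus I R} {L : SeqHistory T I R}

theorem tracks_tau (hSim : IsForwardSimulation A Spec Sim) (hs : Tracks Sim s st L)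
    (hstep : A.Step s t .tau s') :
    ∃ M st', TakeEffect st M st' ∧ Tracks Sim s' st' (L ++ M) := by
  obtain ⟨h, hs, hl⟩ := hs
  obtain ⟨_, ⟨M, rfl⟩, hs'⟩ := hSim.step hstep hs
  simp only [StepAction.event?, Option.toList_none, List.append_nil] at hs'
  obtain ⟨st', hM, hl'⟩ := hl.exists_takeEffect (hSim.sound hs').2
  exact ⟨M, st', hM, h, hs', hl'⟩

theorem tracks_invoke (hSim : IsForwardSimulation A Spec Sim) (hs : Tracks Sim s st L) {i : I}
    (hstep : A.Step s t (.inv i) s') (ht : st t = .idle) :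
    ∃ p M st', TakeEffect (Function.update st t (.pending p i)) M st' ∧
      Tracks Sim s' st' (L ++ M) := by
  obtain ⟨h, hs, hl⟩ := hs
  obtain ⟨_, ⟨M, rfl⟩, hs'⟩ := hSim.step hstep hs
  obtain ⟨st', hM, hl'⟩ := (hl.invoke ht i).exists_takeEffect (hSim.sound hs').2
  exact ⟨h.length, M, st', hM, _, hs', hl'⟩

theorem tracks_respond (hSim : IsForwardSimulation A Spec Sim) (hs : Tracks Sim s st L) {r : R}
    (hstep : A.Step s t (.res r) s') (ht : st t ≠ .idle) :
    ∃ M st' p i, TakeEffect st M st' ∧ st' t = .done p i r ∧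
      Tracks Sim s' (Function.update st' t .idle) (L ++ M) := by
  obtain ⟨h, hs, hl⟩ := hs
  obtain ⟨_, ⟨M, rfl⟩, hs'⟩ := hSim.step hstep hs
  have hLM : IsSerialisation (h ++ [.res t r]) (L ++ M) := (hSim.sound hs').2
  obtain ⟨st', hM, hl'⟩ := hl.exists_takeEffect hLM.of_concat_res
  obtain ⟨p, i, hst'⟩ := hl'.exists_eq_done hLM (hM.ne_idle ht)
  exact ⟨M, st', p, i, hM, hst', _, hs', hl'.respond hst'⟩

end IsForwardSimulation

end Tracking

theorem SharedObject.Step.imp {T I R : Type*} [DecidableEq T] {O : SharedObject T I R}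
    {P P' : T → I → Prop} {g g' : O.Config} {t : T} {α : StepAction I R}
    (hstep : O.Step P g t α g') (hα : ∀ i, α = .inv i → P' t i) : O.Step P' g t α g' := by
  cases hstep with
  | invoke m p _ i _ hp => exact .invoke m p t i (hα i rfl) hp
  | internal m m' p _ l l' hp hnext => exact .internal m m' p t l l' hp hnext
  | respond m m' p _ l r hp hnext => exact .respond m m' p t l r hp hnext

section Relaxation

theorem ncard_lt_and_forall_ne_le {m n r : ℕ} {φ : Fin m → Fin n} (hφ : Function.Injective φ)
    (hle : ∀ k, (φ k : ℕ) ≤ k + r) (k : Fin m) :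
    {j | j < φ k ∧ ∀ i, i < k → φ i ≠ j}.ncard ≤ r := by
  let missed := {j | j < φ k ∧ ∀ i, i < k → φ i ≠ j}
  have himage : (φ '' Set.Iio k).ncard = k := by
    rw [Set.ncard_image_of_injective _ hφ, ← Finset.coe_Iio, Set.ncard_coe_finset, Fin.card_Iio]
  have hdisj : Disjoint missed (φ '' Set.Iio k) :=
    Set.disjoint_left.2 fun j hj ⟨i, hi, hij⟩ => hj.2 i hi hij
  have hsub : (missed ∪ φ '' Set.Iio k).ncard ≤ (Finset.range (k + r) : Set ℕ).ncard := by
    refine Set.ncard_le_ncard_of_injOn Fin.val ?_ Fin.val_injective.injOn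
    rintro j (⟨hj, -⟩ | ⟨i, hi, rfl⟩)
    · exact Finset.mem_coe.2 (Finset.mem_range.2 (lt_of_lt_of_le hj (hle k)))
    · exact Finset.mem_coe.2 (Finset.mem_range.2 ((hle i).trans_lt (Nat.add_lt_add_right hi r)))
  rw [Set.ncard_union_eq hdisj, himage, Set.ncard_coe_finset, Finset.card_range] at hsub
  change missed.ncard ≤ r
  lia

variable {T I R : Type*}

/-- The call at position `k` of `V` is among the first `k + r + 1` calls of `H`. -/
def IsEarly (r : ℕ) (V H : SeqHistory T I R) : Prop :=
  ∀ k (hk : k < V.length), V[k] ∈ H.take (k + r + 1)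

namespace IsEarly

variable {r : ℕ} {V W H : SeqHistory T I R}

theorem mono_right (hVH : IsEarly r V H) {H' : SeqHistory T I R} (hH : H <+: H') :
    IsEarly r V H' :=
  fun k hk => (hH.take _).subset (hVH k hk)

theorem append (hVH : IsEarly r V H) (hlen : H.length ≤ V.length + r + 1) (hW : W ⊆ H) :
    IsEarly r (V ++ W) H := by
  intro k hk
  rcases lt_or_ge k V.length with hkV | hkV
  · rw [List.getElem_append_left hkV]
    exact hVH k hkV
  · rw [List.getElem_append_right hkV, List.take_of_length_le (by lia)]
    exact hW (List.getElem_mem _)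

theorem isRelaxation (hVH : IsEarly r V H) (hV : V.Nodup) (hlen : H.length ≤ V.length + r) :
    IsRelaxation r V H := by
  have hex (k : Fin V.length) : ∃ j : Fin H.length, V[k] = H[j] ∧ (j : ℕ) ≤ k + r := by
    obtain ⟨j, hj, hjk⟩ := List.mem_take_iff_getElem.1 (hVH k k.2)
    exact ⟨⟨j, by lia⟩, hjk.symm, by simp only; lia⟩
  choose φ hφ hle using hex
  have hinj : Function.Injective φ := fun i k hik =>
    Fin.ext <| hV.getElem_inj_iff.1 <| show V[i] = V[k] by rw [hφ, hφ, hik]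
  exact ⟨φ, hinj, hφ, hlen, ncard_lt_and_forall_ne_le hinj hle⟩

end IsEarly

end Relaxation

/-- The status of a thread's update or query. -/
abbrev SketchOp (Elem Arg Val : Type*) : Type _ := OpStatus (SketchInv Elem Arg) (SketchRes Val)

/-- A sequential history of updates and queries. -/
abbrev SketchHistory (T Elem Arg Val : Type*) : Type _ :=
  SeqHistory T (SketchInv Elem Arg) (SketchRes Val)

section Streams

variable {T Elem Arg Val : Type*}

/-- The element that a call adds to the sketch. -/
def Call.elem? (c : Call T (SketchInv Elem Arg) (SketchRes Val)) : Option Elem :=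
  match c.inv with
  | .update a => some a
  | .query _ => none

/-- The call `c` is a completed update. -/
def Call.IsUpdate (c : Call T (SketchInv Elem Arg) (SketchRes Val)) : Prop :=
  (∃ a, c.inv = .update a) ∧ c.res = .ack

/-- The stream of the elements that the updates in a sequential history add to the sketch. -/
def stream (V : SketchHistory T Elem Arg Val) : List Elem :=
  V.filterMap Call.elem?

theorem stream_append (V W : SketchHistory T Elem Arg Val) :
    stream (V ++ W) = stream V ++ stream W :=
  List.filterMap_append

theorem stream_isPrefix_stream {V W : SketchHistory T Elem Arg Val} (h : V <+: W) :
    stream V <+: stream W :=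
  h.filterMap _

end Streams

namespace SketchMethods

variable {Elem Arg Val Hint T : Type*} (S : SketchMethods Elem Arg Val Hint)

/-- The state that summarises the stream `A`. -/
def summary (A : List Elem) : S.State :=
  A.foldl S.update S.empty

/-- The hint `h` filters out only elements that do not change the summary of a stream that
starts with `A`. -/
def IsHintFor (h : Hint) (A : List Elem) : Prop :=
  ∀ a, S.shouldAdd h a = false → ∀ B, S.summary (A ++ B ++ [a]) = S.summary (A ++ B)

/-- The state in which the calls of `L` leave a global sketch that is in state `s` before. -/
def globalFinal (s : S.State) (L : SeqHistory T (GlobalInv S.State) (GlobalRes S.State Hint)) :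
    S.State :=
  L.foldl (fun s c => match c.inv with
    | .merge s' => S.merge s s'
    | .calcHint | .snapshot => s) s

variable {S}

theorem summary_concat (A : List Elem) (a : Elem) :
    S.summary (A ++ [a]) = S.update (S.summary A) a :=
  List.foldl_concat ..

theorem IsHintFor.mono {h : Hint} {A A' : List Elem} (hA : S.IsHintFor h A) (hAA' : A <+: A') :
    S.IsHintFor h A' := by
  obtain ⟨A'', rfl⟩ := hAA'
  intro a ha B
  rw [List.append_assoc A]
  exact hA a ha (A'' ++ B)

theorem seqRun_append {s : S.State} {V W : SketchHistory T Elem Arg Val} :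
    S.SeqRun s (V ++ W) ↔ S.SeqRun s V ∧ S.SeqRun ((stream V).foldl S.update s) W := by
  induction V generalizing s with
  | nil => simp [SeqRun, stream]
  | cons c V ih => cases h : c.inv <;> simp [SeqRun, stream, Call.elem?, h, ih, and_assoc]

theorem seqRun_of_isUpdate {s : S.State} {W : SketchHistory T Elem Arg Val}
    (hW : ∀ c ∈ W, c.IsUpdate) : S.SeqRun s W := by
  induction W generalizing s with
  | nil => trivial
  | cons c W ih =>
    obtain ⟨⟨⟨a, ha⟩, hres⟩, hW⟩ := List.forall_mem_cons.1 hW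
    simp only [SeqRun, ha]
    exact ⟨hres, ih hW⟩

theorem globalFinal_append (s : S.State)
    (L M : SeqHistory T (GlobalInv S.State) (GlobalRes S.State Hint)) :
    S.globalFinal s (L ++ M) = S.globalFinal (S.globalFinal s L) M :=
  List.foldl_append

theorem globalRun_append {s : S.State}
    {L M : SeqHistory T (GlobalInv S.State) (GlobalRes S.State Hint)} :
    S.GlobalRun s (L ++ M) ↔ S.GlobalRun s L ∧ S.GlobalRun (S.globalFinal s L) M := by
  induction L generalizing s with
  | nil => simp [GlobalRun, globalFinal]
  | cons c L ih => cases h : c.inv <;> simp [GlobalRun, globalFinal, h, ih, and_assoc]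

end SketchMethods

namespace ComposableSketch

variable {Elem Arg Val Hint Q : Type*} [Zero Hint] [One Hint] [DecidableEq Q]
  (S : ComposableSketch Elem Arg Val Hint Q)

theorem merge_summary (A A' : List Elem) :
    S.merge (S.summary A) (S.summary A') = S.summary (A ++ A') :=
  S.merge_summarises _ _ A A' rfl rfl

theorem isHintFor_one (A : List Elem) : S.IsHintFor 1 A := fun a ha B => by
  have h := S.shouldAdd_one a ha (A ++ B) [] (S.summary (A ++ B ++ [a]))
  simp only [List.append_nil] at h
  exact h rfl

theorem isHintFor_calcHint (A : List Elem) : S.IsHintFor (S.calcHint (S.summary A)) A :=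
  fun a ha B => by
    have h := S.shouldAdd_calcHint _ A a rfl ha B [] (S.summary (A ++ B ++ [a]))
    simp only [List.append_nil] at h
    exact h rfl

end ComposableSketch

theorem sum_add_eq_sum_add_of_forall_ne {M ι : Type*} [AddCommMonoid M] [Fintype ι] {f g : ι → M}
    {m n : M} (i : ι) (hi : f i + m = g i + n) (hne : ∀ j, j ≠ i → f j = g j) :
    ∑ j, f j + m = ∑ j, g j + n := by
  classical
  rw [← Finset.add_sum_erase _ f (Finset.mem_univ i),
    ← Finset.add_sum_erase _ g (Finset.mem_univ i),
    Finset.sum_congr rfl fun j hj => hne j (Finset.ne_of_mem_erase hj), add_right_comm, hi,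
    add_right_comm]

/-- What the simulation records beside the state of the algorithm: the status of each thread, the
calls that have taken effect, those among them that queries see, in the order in which they became
visible, and for each update thread the calls whose elements are in its current buffer and those
whose elements are in the auxiliary buffer that it hands to the propagator. -/
structure Ledger (T ι Elem Arg Val : Type*) where
  ops : T → SketchOp Elem Arg Val
  linearised : SketchHistory T Elem Arg Val
  visible : SketchHistory T Elem Arg Val
  current : ι → SketchHistory T Elem Arg Val
  handed : ι → SketchHistory T Elem Arg Val

/-- The possible contents of a buffer of size `b`. -/
structure IsBuffer {T Elem Arg Val : Type*} (b : ℕ) (W : SketchHistory T Elem Arg Val) :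
    Prop where
  length_le : W.length ≤ b
  isUpdate : ∀ c ∈ W, c.IsUpdate

theorem IsBuffer.nil {T Elem Arg Val : Type*} {b : ℕ} :
    IsBuffer b ([] : SketchHistory T Elem Arg Val) :=
  ⟨Nat.zero_le b, by simp⟩

namespace Ledger

variable {T ι Elem Arg Val Hint : Type*}

section Transitions

variable [DecidableEq T] [DecidableEq ι] (G : Ledger T ι Elem Arg Val)

/-- The status of thread `t` becomes `o`. -/
def setOp (t : T) (o : SketchOp Elem Arg Val) : Ledger T ι Elem Arg Val :=
  { G with ops := Function.update G.ops t o }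

/-- The call `c` takes effect. -/
def linearise (c : Call T (SketchInv Elem Arg) (SketchRes Val)) : Ledger T ι Elem Arg Val :=
  { G.setOp c.thread (.done c.id c.inv c.res) with linearised := G.linearised ++ [c] }

/-- The call `c` takes effect and is visible at once. -/
def expose (c : Call T (SketchInv Elem Arg) (SketchRes Val)) : Ledger T ι Elem Arg Val :=
  { G.linearise c with visible := G.visible ++ [c] }

/-- The update `c` takes effect, and its element is put into the current buffer of thread `i`. -/
def buffer (i : ι) (c : Call T (SketchInv Elem Arg) (SketchRes Val)) :
    Ledger T ι Elem Arg Val :=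
  { G.linearise c with current := Function.update G.current i (G.current i ++ [c]) }

/-- Thread `i` hands over its current buffer and starts a new one. -/
def swap (i : ι) : Ledger T ι Elem Arg Val :=
  { G with
    current := Function.update G.current i []
    handed := Function.update G.handed i (G.current i) }

/-- The updates in the buffer that thread `i` handed over become visible. -/
def publish (i : ι) : Ledger T ι Elem Arg Val :=
  { G with
    visible := G.visible ++ G.handed i
    handed := Function.update G.handed i [] }

end Transitions

variable [Fintype ι]

/-- The ledger `G` is consistent with the history `h`: every linearised call is visible or in
exactly one buffer, so that at most `2 * Fintype.card ι * b` linearised calls are not visible. -/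
structure Valid (S : SketchMethods Elem Arg Val Hint) (b : ℕ)
    (h : List (Event T (SketchInv Elem Arg) (SketchRes Val))) (G : Ledger T ι Elem Arg Val) :
    Prop where
  linearises : Linearises h G.ops G.linearised
  account : ∑ i, (Multiset.ofList (G.current i) + Multiset.ofList (G.handed i)) +
    Multiset.ofList G.visible = Multiset.ofList G.linearised
  early : IsEarly (2 * Fintype.card ι * b) G.visible G.linearised
  run : S.SeqRun S.empty G.visible
  current : ∀ i, IsBuffer b (G.current i)
  handed : ∀ i, IsBuffer b (G.handed i)

namespace Valid

variable {S : SketchMethods Elem Arg Val Hint} {b : ℕ}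
  {h : List (Event T (SketchInv Elem Arg) (SketchRes Val))} {G : Ledger T ι Elem Arg Val}

theorem length_le (hG : G.Valid S b h) :
    G.linearised.length ≤ G.visible.length + 2 * Fintype.card ι * b := by
  have hcard := congrArg Multiset.card hG.account
  simp only [Multiset.card_add, Multiset.coe_card, Multiset.card_sum] at hcard
  calc G.linearised.length
      = ∑ i, ((G.current i).length + (G.handed i).length) + G.visible.length := hcard.symm
    _ ≤ ∑ _i : ι, (b + b) + G.visible.length := by
        gcongr with i
        exacts [(hG.current i).length_le, (hG.handed i).length_le]
    _ = G.visible.length + 2 * Fintype.card ι * b := by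
        rw [Finset.sum_const, Finset.card_univ, smul_eq_mul]
        ring

theorem handed_subset (hG : G.Valid S b h) (i : ι) : G.handed i ⊆ G.linearised := by
  have hle : Multiset.ofList (G.handed i) ≤ Multiset.ofList G.linearised :=
    calc Multiset.ofList (G.handed i)
        ≤ Multiset.ofList (G.current i) + Multiset.ofList (G.handed i) := le_add_self
      _ ≤ ∑ k, (Multiset.ofList (G.current k) + Multiset.ofList (G.handed k)) :=
          Finset.single_le_sum_of_canonicallyOrdered
            (f := fun k => Multiset.ofList (G.current k) + Multiset.ofList (G.handed k))
            (Finset.mem_univ i)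
      _ ≤ Multiset.ofList G.linearised := hG.account ▸ le_self_add
  exact (Multiset.coe_le.1 hle).subset

theorem mem_relaxed (hG : G.Valid S b h) :
    G.linearised ∈ Relaxed (SeqSketch S T) (2 * Fintype.card ι * b) := by
  have hnodup : (Multiset.ofList G.linearised).Nodup :=
    Multiset.coe_nodup.2 (.of_map _ hG.linearises.isSerialisation.nodup)
  rw [← hG.account] at hnodup
  exact ⟨G.visible, hG.run,
    hG.early.isRelaxation (Multiset.nodup_add.1 hnodup).2.1 hG.length_le⟩

section

variable [DecidableEq ι]

theorem swap (hG : G.Valid S b h) {i : ι} (hi : G.handed i = []) : (G.swap i).Valid S b h :=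
  { hG with
    account := by
      have hmove := sum_add_eq_sum_add_of_forall_ne
        (f := fun k => Multiset.ofList ((G.swap i).current k) +
          Multiset.ofList ((G.swap i).handed k))
        (g := fun k => Multiset.ofList (G.current k) + Multiset.ofList (G.handed k))
        (m := Multiset.ofList G.visible) (n := Multiset.ofList G.visible) i
        (by simp [Ledger.swap, hi])
        (fun j hj => by simp only [Ledger.swap, Function.update_of_ne hj])
      exact hmove.trans hG.account
    current := (Function.forall_update_iff G.current fun _ W => IsBuffer b W).2
      ⟨.nil, fun k _ => hG.current k⟩
    handed := (Function.forall_update_iff G.handed fun _ W => IsBuffer b W).2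
      ⟨hG.current i, fun k _ => hG.handed k⟩ }

theorem publish (hG : G.Valid S b h) (i : ι) : (G.publish i).Valid S b h :=
  { hG with
    account := by
      have hmove := sum_add_eq_sum_add_of_forall_ne
        (f := fun k => Multiset.ofList (G.current k) + Multiset.ofList ((G.publish i).handed k))
        (g := fun k => Multiset.ofList (G.current k) + Multiset.ofList (G.handed k))
        (m := Multiset.ofList (G.publish i).visible) (n := Multiset.ofList G.visible) i
        (by simp only [Ledger.publish, Function.update_self, ← Multiset.coe_add,
              Multiset.coe_nil]; abel)
        (fun j hj => by simp only [Ledger.publish, Function.update_of_ne hj])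
      exact hmove.trans hG.account
    early := hG.early.append (hG.length_le.trans (Nat.le_succ _)) (hG.handed_subset i)
    run := SketchMethods.seqRun_append.2
      ⟨hG.run, SketchMethods.seqRun_of_isUpdate (hG.handed i).isUpdate⟩
    handed := (Function.forall_update_iff G.handed fun _ W => IsBuffer b W).2
      ⟨.nil, fun k _ => hG.handed k⟩ }

end

variable [DecidableEq T]

theorem invoke (hG : G.Valid S b h) {t : T} (ht : G.ops t = .idle) (i : SketchInv Elem Arg) :
    (G.setOp t (.pending h.length i)).Valid S b (h ++ [.inv t i]) :=
  { hG with linearises := hG.linearises.invoke ht i }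

theorem respond (hG : G.Valid S b h) {t : T} {p : ℕ} {i : SketchInv Elem Arg}
    {r : SketchRes Val} (ht : G.ops t = .done p i r) :
    (G.setOp t .idle).Valid S b (h ++ [.res t r]) :=
  { hG with linearises := hG.linearises.respond ht }

theorem expose (hG : G.Valid S b h) {c : Call T (SketchInv Elem Arg) (SketchRes Val)}
    (hc : G.ops c.thread = .pending c.id c.inv)
    (hrun : S.SeqRun (S.summary (stream G.visible)) [c]) : (G.expose c).Valid S b h :=
  { hG with
    linearises := hG.linearises.linearise hc
    account := by
      simp only [Ledger.expose, Ledger.linearise, setOp, ← Multiset.coe_add]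
      rw [← add_assoc, hG.account]
    early := by
      refine (hG.early.mono_right (List.prefix_append _ _)).append ?_ (by simp)
      simpa [Ledger.linearise] using hG.length_le
    run := SketchMethods.seqRun_append.2 ⟨hG.run, hrun⟩ }

theorem buffer [DecidableEq ι] (hG : G.Valid S b h) {i : ι}
    {c : Call T (SketchInv Elem Arg) (SketchRes Val)}
    (hc : G.ops c.thread = .pending c.id c.inv) (hupdate : c.IsUpdate)
    (hlen : (G.current i).length < b) : (G.buffer i c).Valid S b h :=
  { hG with
    linearises := hG.linearises.linearise hc
    account := by
      have hmove := sum_add_eq_sum_add_of_forall_ne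
        (f := fun k => Multiset.ofList ((G.buffer i c).current k) + Multiset.ofList (G.handed k))
        (g := fun k => Multiset.ofList (G.current k) + Multiset.ofList (G.handed k))
        (m := Multiset.ofList G.visible)
        (n := Multiset.ofList G.visible + Multiset.ofList [c]) i
        (by simp only [Ledger.buffer, Function.update_self, ← Multiset.coe_add]; abel)
        (fun j hj => by simp only [Ledger.buffer, Function.update_of_ne hj])
      rw [← add_assoc, hG.account, Multiset.coe_add] at hmove
      exact hmove
    early := hG.early.mono_right (List.prefix_append _ _)
    current := by
      refine (Function.forall_update_iff G.current fun _ W => IsBuffer b W).2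
        ⟨⟨?_, ?_⟩, fun k _ => hG.current k⟩
      · simpa using hlen
      · exact List.forall_mem_append.2
          ⟨(hG.current i).isUpdate, List.forall_mem_singleton.2 hupdate⟩ }

end Valid

end Ledger

section ThreadInvariants

variable {Elem Arg Val Hint T : Type*}

/-- The variables of an update thread. -/
structure UpdateVars (σ Hint : Type*) where
  cur : Bool
  counter : ℕ
  hint : Hint
  prop : Hint
  localS : Bool → σ

/-- The auxiliary local sketch, which the propagator merges into the global one. -/
def UpdateVars.aux {σ : Type*} (v : UpdateVars σ Hint) : σ :=
  v.localS (!v.cur)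

/-- What the program counter of an update thread says about the status of its operation, which
takes effect when the element is either filtered out or put into the local sketch. -/
def OpInv (o : SketchOp Elem Arg Val) : UpdatePC Elem → Prop
  | .idle => o = .idle
  | .shouldAdd a | .incCounter a | .updateLocal a => ∃ p, o = .pending p (.update a)
  | _ => ∃ p a, o = .done p (.update a) .ack

/-- What the program counter of an update thread says about the number `n` of elements in its
current buffer. -/
def CountInv (b counter n : ℕ) : UpdatePC Elem → Prop
  | .idle | .shouldAdd _ | .incCounter _ | .respond => counter = n ∧ n < b
  | .updateLocal _ => counter = n + 1 ∧ n < b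
  | .checkFull => counter = n ∧ n ≤ b
  | .wait | .swap => True
  | .updateHint | .zeroCounter => n = 0
  | .signal => counter = 0 ∧ n = 0

/-- What the program counter of an update thread says about its variable `prop` and the contents
`pb` of its auxiliary buffer: `prop` is nonzero exactly while the thread, rather than the
propagator, owns that buffer. -/
def HandoverInv [Zero Hint] (prop : Hint) (pb : SketchHistory T Elem Arg Val) :
    UpdatePC Elem → Prop
  | .swap => prop ≠ 0 ∧ pb = []
  | .updateHint | .zeroCounter | .signal => prop ≠ 0
  | _ => prop ≠ 0 → pb = []

theorem HandoverInv.of_prop_eq_zero [Zero Hint] {prop prop' : Hint}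
    {pb : SketchHistory T Elem Arg Val} {pc : UpdatePC Elem} (h : HandoverInv prop pb pc)
    (hprop : prop = 0) : HandoverInv prop' ([] : SketchHistory T Elem Arg Val) pc := by
  cases pc <;> simp_all [HandoverInv]

/-- The invariant of an update thread with program counter `pc`, variables `v` and status `o`,
while the visible updates add the stream `A`, the current buffer contains `cb` and the auxiliary
one `pb`. -/
structure UpdateInv [Zero Hint] (S : SketchMethods Elem Arg Val Hint) (b : ℕ)
    (pc : UpdatePC Elem) (v : UpdateVars S.State Hint) (o : SketchOp Elem Arg Val)
    (A : List Elem) (cb pb : SketchHistory T Elem Arg Val) : Prop where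
  op : OpInv o pc
  count : CountInv b v.counter cb.length pc
  current : v.localS v.cur = S.summary (stream cb)
  hint : S.IsHintFor v.hint A
  prop : v.prop ≠ 0 → S.IsHintFor v.prop A
  handover : HandoverInv v.prop pb pc

namespace UpdateInv

variable [Zero Hint] {S : SketchMethods Elem Arg Val Hint} {b : ℕ} {pc : UpdatePC Elem}
  {v : UpdateVars S.State Hint} {o : SketchOp Elem Arg Val} {A : List Elem}
  {cb pb : SketchHistory T Elem Arg Val} {a : Elem}

theorem mono (h : UpdateInv S b pc v o A cb pb) {A' : List Elem} (hA : A <+: A') :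
    UpdateInv S b pc v o A' cb pb :=
  { h with
    hint := h.hint.mono hA
    prop := fun hprop => (h.prop hprop).mono hA }

theorem invoke (h : UpdateInv S b .idle v o A cb pb) (p : ℕ) :
    UpdateInv S b (.shouldAdd a) v (.pending p (.update a)) A cb pb :=
  { h with op := ⟨p, rfl⟩ }

theorem filter (h : UpdateInv S b (.shouldAdd a) v o A cb pb) (p : ℕ) :
    UpdateInv S b .respond v (.done p (.update a) .ack) (A ++ [a]) cb pb :=
  { h.mono (List.prefix_append A [a]) with
    op := ⟨p, a, rfl⟩
    count := h.count
    handover := h.handover }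

theorem add (h : UpdateInv S b (.shouldAdd a) v o A cb pb) :
    UpdateInv S b (.incCounter a) v o A cb pb :=
  { h with }

theorem incCounter (h : UpdateInv S b (.incCounter a) v o A cb pb) :
    UpdateInv S b (.updateLocal a) { v with counter := v.counter + 1 } o A cb pb :=
  { h with count := ⟨congrArg (· + 1) h.count.1, h.count.2⟩ }

theorem updateLocal (h : UpdateInv S b (.updateLocal a) v o A cb pb) (p : ℕ) (t : T) :
    UpdateInv S b .checkFull
      { v with localS := Function.update v.localS v.cur (S.update (v.localS v.cur) a) }
      (.done p (.update a) .ack) A (cb ++ [⟨p, t, .update a, .ack⟩]) pb :=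
  { h with
    op := ⟨p, a, rfl⟩
    count := by simpa [CountInv] using h.count
    current := by
      rw [stream_append]
      exact (Function.update_self ..).trans
        ((congrArg (S.update · a) h.current).trans (S.summary_concat _ _).symm) }

theorem notFull (h : UpdateInv S b .checkFull v o A cb pb) (hb : v.counter ≠ b) :
    UpdateInv S b .respond v o A cb pb :=
  { h with count := ⟨h.count.1, h.count.2.lt_of_ne (h.count.1 ▸ hb)⟩ }

theorem full (h : UpdateInv S b .checkFull v o A cb pb) : UpdateInv S b .wait v o A cb pb :=
  { h with count := trivial }

theorem wait (h : UpdateInv S b .wait v o A cb pb) (hprop : v.prop ≠ 0) :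
    UpdateInv S b .swap v o A cb pb :=
  { h with handover := ⟨hprop, h.handover hprop⟩ }

theorem swap (h : UpdateInv S b .swap v o A cb pb) (haux : v.aux = S.summary (stream pb)) :
    UpdateInv S b .updateHint { v with cur := !v.cur } o A [] cb :=
  { h with
    count := rfl
    current := h.handover.2 ▸ haux
    handover := h.handover.1 }

theorem updateHint (h : UpdateInv S b .updateHint v o A cb pb) :
    UpdateInv S b .zeroCounter { v with hint := v.prop } o A cb pb :=
  { h with hint := h.prop h.handover }

theorem zeroCounter (h : UpdateInv S b .zeroCounter v o A cb pb) :
    UpdateInv S b .signal { v with counter := 0 } o A cb pb :=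
  { h with count := ⟨rfl, h.count⟩ }

theorem signal (h : UpdateInv S b .signal v o A cb pb) (hb : 0 < b) :
    UpdateInv S b .respond { v with prop := 0 } o A cb pb :=
  { h with
    count := ⟨h.count.1.trans h.count.2.symm, h.count.2 ▸ hb⟩
    prop := absurd rfl
    handover := absurd rfl }

theorem respond (h : UpdateInv S b .respond v o A cb pb) : UpdateInv S b .idle v .idle A cb pb :=
  { h with op := rfl }

theorem emptyAux (h : UpdateInv S b pc v o A cb pb) :
    UpdateInv S b pc { v with localS := Function.update v.localS (!v.cur) S.empty } o A cb pb :=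
  { h with current := (Function.update_of_ne (Bool.self_ne_not _) _ _).trans h.current }

theorem publish (h : UpdateInv S b pc v o A cb pb) (hprop : v.prop = 0) :
    UpdateInv S b pc v o A cb [] :=
  { h with handover := h.handover.of_prop_eq_zero hprop }

theorem setProp (h : UpdateInv S b pc v o A cb []) (hprop : v.prop = 0) {x : Hint}
    (hx : S.IsHintFor x A) :
    UpdateInv S b pc { v with prop := x } o A cb ([] : SketchHistory T Elem Arg Val) :=
  { h with
    prop := fun _ => hx
    handover := h.handover.of_prop_eq_zero hprop }

end UpdateInv

/-- The status of a thread's operation on the global sketch. -/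
abbrev SketchMethods.GlobalOp (S : SketchMethods Elem Arg Val Hint) : Type _ :=
  OpStatus (GlobalInv S.State) (GlobalRes S.State Hint)

/-- The update thread whose auxiliary buffer the propagator works on. -/
def PropagatorPC.target {N : ℕ} : PropagatorPC N Hint → Option (Fin N)
  | .scan => none
  | .merge i | .merging i | .emptyLocal i | .calcHint i | .calculating i | .setProp i _ => some i

/-- What the program counter of the propagator says about the status `o` of its operation on the
global sketch and about the auxiliary sketch `aux i` and buffer `pb i` of its target `i`, while the
visible updates add the stream `A`. The buffer is published when the `merge` takes effect. -/
def PropagatorInv {N : ℕ} (S : SketchMethods Elem Arg Val Hint) (o : S.GlobalOp) (A : List Elem)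
    (aux : Fin N → S.State) (pb : Fin N → SketchHistory T Elem Arg Val) :
    PropagatorPC N Hint → Prop
  | .scan => o = .idle
  | .merge i => o = .idle ∧ aux i = S.summary (stream (pb i))
  | .merging i => ∃ p, o = .pending p (.merge (S.summary (stream (pb i)))) ∨
      (∃ s r, o = .done p (.merge s) r) ∧ pb i = []
  | .emptyLocal i => o = .idle ∧ pb i = []
  | .calcHint i => o = .idle ∧ pb i = [] ∧ aux i = S.empty
  | .calculating i => (∃ p, o = .pending p .calcHint ∨
      ∃ h, o = .done p .calcHint (.hint h) ∧ S.IsHintFor h A) ∧ pb i = [] ∧ aux i = S.empty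
  | .setProp i h => o = .idle ∧ S.IsHintFor h A ∧ pb i = [] ∧ aux i = S.empty

theorem PropagatorInv.congr {N : ℕ} {S : SketchMethods Elem Arg Val Hint} {o : S.GlobalOp}
    {A A' : List Elem} {aux aux' : Fin N → S.State}
    {pb pb' : Fin N → SketchHistory T Elem Arg Val} {pc : PropagatorPC N Hint}
    (h : PropagatorInv S o A aux pb pc) (hA : A <+: A')
    (htarget : ∀ i, pc.target = some i → aux' i = aux i ∧ pb' i = pb i) :
    PropagatorInv S o A' aux' pb' pc := by
  cases pc with
  | scan => exact h
  | merge i | merging i | emptyLocal i | calcHint i =>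
    simpa only [PropagatorInv, htarget i rfl] using h
  | calculating i =>
    obtain ⟨⟨p, ho⟩, hpb, haux⟩ := h
    refine ⟨⟨p, ho.imp_right ?_⟩, by rw [(htarget i rfl).2, hpb], by rw [(htarget i rfl).1, haux]⟩
    exact fun ⟨x, hox, hx⟩ => ⟨x, hox, hx.mono hA⟩
  | setProp i x =>
    simp only [PropagatorInv, htarget i rfl]
    exact ⟨h.1, h.2.1.mono hA, h.2.2⟩

theorem PropagatorInv.exists_of_pending {N : ℕ} {S : SketchMethods Elem Arg Val Hint} {p : ℕ}
    {x : GlobalInv S.State} {A : List Elem} {aux : Fin N → S.State}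
    {pb : Fin N → SketchHistory T Elem Arg Val} {pc : PropagatorPC N Hint}
    (h : PropagatorInv S (.pending p x) A aux pb pc) :
    (∃ i, pc = .merging i ∧ x = .merge (S.summary (stream (pb i)))) ∨
      ∃ i, pc = .calculating i ∧ x = .calcHint := by
  cases pc <;> simp_all [PropagatorInv]

/-- What the program counter of a query thread says about the status `o` of its operation and
about the status `gq` of its operation on the global sketch: the query takes effect together with
its snapshot. -/
def QueryInv (S : SketchMethods Elem Arg Val Hint) (o : SketchOp Elem Arg Val) (gq : S.GlobalOp) :
    QueryPC Arg S.State → Prop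
  | .idle => o = .idle ∧ gq = .idle
  | .snapshot x => (∃ p, o = .pending p (.query x)) ∧ gq = .idle
  | .snapshotting x => ∃ p q, (o = .pending p (.query x) ∧ gq = .pending q .snapshot) ∨
      ∃ s, o = .done p (.query x) (.value (S.query s x)) ∧ gq = .done q .snapshot (.copy s)
  | .respond x s => (∃ p, o = .done p (.query x) (.value (S.query s x))) ∧ gq = .idle

theorem QueryInv.exists_of_pending {S : SketchMethods Elem Arg Val Hint}
    {o : SketchOp Elem Arg Val} {q : ℕ} {i : GlobalInv S.State} {pc : QueryPC Arg S.State}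
    (h : QueryInv S o (.pending q i) pc) :
    ∃ x p, pc = .snapshotting x ∧ o = .pending p (.query x) ∧ i = .snapshot := by
  cases pc <;> simp_all [QueryInv]

end ThreadInvariants

section Coupling

variable {Elem Arg Val Hint Q : Type*} [Zero Hint] [One Hint] [DecidableEq Q]
  {S : ComposableSketch Elem Arg Val Hint Q} {N b : ℕ}

noncomputable instance : DecidableEq (OptThread N Q) := Classical.decEq _

/-- The variables of update thread `i`. -/
def OptState.vars (s : OptState S N) (i : Fin N) : UpdateVars S.State Hint where
  cur := s.cur i
  counter := s.counter i
  hint := s.hint i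
  prop := s.prop i
  localS := s.localS i

/-- The states `s` and `s'` differ only in the program counter and the variables of update
thread `i`. -/
structure OptState.AgreeOff (i : Fin N) (s s' : OptState S N) : Prop where
  globalS : s'.globalS = s.globalS
  propagatorPC : s'.propagatorPC = s.propagatorPC
  queryPC : s'.queryPC = s.queryPC
  updatePC : ∀ k, k ≠ i → s'.updatePC k = s.updatePC k
  vars : ∀ k, k ≠ i → s'.vars k = s.vars k

theorem OptStep.agreeOff {s s' : OptState S N} {i : Fin N}
    {α : StepAction (SketchInv Elem Arg) (SketchRes Val)}
    (hstep : OptStep S N b s (.update i) α s') : s.AgreeOff i s' := by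
  cases hstep <;> constructor <;>
    simp +contextual [OptState.gotoU, OptState.setLocal, OptState.vars]

/-- The ledger `G'` arises from `G` by an action of update thread `i`. -/
structure Ledger.AgreeOff (i : Fin N) (G G' : Ledger (OptThread N Q) (Fin N) Elem Arg Val) :
    Prop where
  ops : ∀ t, t ≠ .update i → G'.ops t = G.ops t
  visible : G.visible <+: G'.visible
  current : ∀ k, k ≠ i → G'.current k = G.current k
  handed : ∀ k, k ≠ i → G'.handed k = G.handed k

variable {s s' : OptState S N} {gst : GlobalThread Q → S.GlobalOp}
  {G G' : Ledger (OptThread N Q) (Fin N) Elem Arg Val}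

/-- The program counters and variables of all threads fit the statuses `gst` of the operations on
the global sketch and the ledger `G`. -/
structure Coupled (b : ℕ) (s : OptState S N) (gst : GlobalThread Q → S.GlobalOp)
    (G : Ledger (OptThread N Q) (Fin N) Elem Arg Val) : Prop where
  update : ∀ i, UpdateInv S.toSketchMethods b (s.updatePC i) (s.vars i) (G.ops (.update i))
    (stream G.visible) (G.current i) (G.handed i)
  aux : ∀ i, s.propagatorPC.target ≠ some i → (s.vars i).aux = S.summary (stream (G.handed i))
  target : ∀ i, s.propagatorPC.target = some i → s.prop i = 0
  propagator : PropagatorInv S.toSketchMethods (gst .propagator) (stream G.visible)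
    (fun i => (s.vars i).aux) G.handed s.propagatorPC
  query : ∀ j, QueryInv S.toSketchMethods (G.ops (.query j)) (gst (.query j)) (s.queryPC j)

namespace Coupled

theorem target_ne (hC : Coupled b s gst G) {i : Fin N} (hprop : s.prop i ≠ 0) :
    s.propagatorPC.target ≠ some i :=
  fun h => hprop (hC.target i h)

theorem of_update (hC : Coupled b s gst G) {i : Fin N} (hs : s.AgreeOff i s')
    (hG : G.AgreeOff i G')
    (hinv : UpdateInv S.toSketchMethods b (s'.updatePC i) (s'.vars i) (G'.ops (.update i))
      (stream G'.visible) (G'.current i) (G'.handed i))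
    (hprop : s.prop i = 0 → s'.prop i = 0 ∧ (s'.vars i).aux = (s.vars i).aux ∧
      G'.handed i = G.handed i)
    (haux : (s.vars i).aux = S.summary (stream (G.handed i)) →
      (s'.vars i).aux = S.summary (stream (G'.handed i))) : Coupled b s' gst G' := by
  have hstream : stream G.visible <+: stream G'.visible := stream_isPrefix_stream hG.visible
  refine ⟨fun k => ?_, fun k hk => ?_, fun k hk => ?_, ?_, fun j => ?_⟩
  · rcases eq_or_ne k i with rfl | hki
    · exact hinv
    · rw [hs.updatePC k hki, hs.vars k hki, hG.ops _ (by simpa using hki), hG.current k hki,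
        hG.handed k hki]
      exact (hC.update k).mono hstream
  · rw [hs.propagatorPC] at hk
    rcases eq_or_ne k i with rfl | hki
    · exact haux (hC.aux k hk)
    · rw [hs.vars k hki, hG.handed k hki, hC.aux k hk]
  · rw [hs.propagatorPC] at hk
    rcases eq_or_ne k i with rfl | hki
    · exact (hprop (hC.target k hk)).1
    · exact (congrArg UpdateVars.prop (hs.vars k hki)).trans (hC.target k hk)
  · rw [hs.propagatorPC]
    refine hC.propagator.congr hstream fun k hk => ?_
    rcases eq_or_ne k i with rfl | hki
    · exact (hprop (hC.target k hk)).2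
    · exact ⟨congrArg UpdateVars.aux (hs.vars k hki), hG.handed k hki⟩
  · rw [hs.queryPC, hG.ops _ (by simp)]
    exact hC.query j

theorem of_update_of_aux_eq (hC : Coupled b s gst G) {i : Fin N} (hs : s.AgreeOff i s')
    (hG : G.AgreeOff i G')
    (hinv : UpdateInv S.toSketchMethods b (s'.updatePC i) (s'.vars i) (G'.ops (.update i))
      (stream G'.visible) (G'.current i) (G'.handed i))
    (hprop : s.prop i = 0 → s'.prop i = 0) (haux : (s'.vars i).aux = (s.vars i).aux)
    (hhanded : G'.handed i = G.handed i) : Coupled b s' gst G' :=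
  hC.of_update hs hG hinv (fun h => ⟨hprop h, haux, hhanded⟩) (by rw [haux, hhanded]; exact id)

theorem of_propagator (hC : Coupled b s gst G) {pc : PropagatorPC N Hint} {o : S.GlobalOp}
    (g : S.shared.Config) (htarget : pc.target = s.propagatorPC.target)
    (hinv : PropagatorInv S.toSketchMethods o (stream G.visible) (fun i => (s.vars i).aux)
      G.handed pc) :
    Coupled b { s with globalS := g, propagatorPC := pc } (Function.update gst .propagator o)
      G where
  update := hC.update
  aux i hi := hC.aux i (htarget ▸ hi)
  target i hi := hC.target i (htarget ▸ hi)
  propagator := by rwa [Function.update_self]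
  query j := by
    rw [Function.update_of_ne (by simp)]
    exact hC.query j

theorem of_query (hC : Coupled b s gst G) {j : Q} {pc : QueryPC Arg S.State} {o : S.GlobalOp}
    (g : S.shared.Config) (hinv : QueryInv S.toSketchMethods (G.ops (.query j)) o pc) :
    Coupled b ({ s with globalS := g }.gotoQ j pc) (Function.update gst (.query j) o) G where
  update := hC.update
  aux := hC.aux
  target := hC.target
  propagator := by
    rw [Function.update_of_ne (by simp)]
    exact hC.propagator
  query k := by
    rcases eq_or_ne k j with rfl | hkj
    · simpa [OptState.gotoQ] using hinv
    · simpa [OptState.gotoQ, hkj] using hC.query k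

theorem setQueryOp (hC : Coupled b s gst G) {j : Q} {pc : QueryPC Arg S.State}
    {o : SketchOp Elem Arg Val} (hinv : QueryInv S.toSketchMethods o (gst (.query j)) pc) :
    Coupled b (s.gotoQ j pc) gst (G.setOp (.query j) o) where
  update i := by
    simpa [Ledger.setOp, OptState.gotoQ, OptState.vars] using hC.update i
  aux := hC.aux
  target := hC.target
  propagator := hC.propagator
  query k := by
    rcases eq_or_ne k j with rfl | hkj
    · simpa [OptState.gotoQ, Ledger.setOp] using hinv
    · simpa [OptState.gotoQ, Ledger.setOp, hkj] using hC.query k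

theorem setGlobalS (hC : Coupled b s gst G) (g : S.shared.Config) :
    Coupled b { s with globalS := g } gst G :=
  { hC with }

theorem select (hC : Coupled b s gst G) {i : Fin N} (hpc : s.propagatorPC = .scan)
    (hprop : s.prop i = 0) : Coupled b { s with propagatorPC := .merge i } gst G where
  update := hC.update
  aux k _ := hC.aux k (by simp [hpc, PropagatorPC.target])
  target k hk := by
    cases hk
    exact hprop
  propagator := by
    have h := hC.propagator
    rw [hpc] at h
    exact ⟨h, hC.aux i (by simp [hpc, PropagatorPC.target])⟩
  query := hC.query

theorem emptyLocal (hC : Coupled b s gst G) {i : Fin N} (hpc : s.propagatorPC = .emptyLocal i) :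
    Coupled b { s.setLocal i (!s.cur i) S.empty with propagatorPC := .calcHint i } gst G where
  update k := by
    rcases eq_or_ne k i with rfl | hki
    · simpa [OptState.setLocal, OptState.vars] using (hC.update k).emptyAux
    · simpa [OptState.setLocal, OptState.vars, hki] using hC.update k
  aux k hk := by
    have hki : k ≠ i := fun h => hk (congrArg some h.symm)
    simpa [OptState.setLocal, OptState.vars, hki] using
      hC.aux k (by simpa [hpc, PropagatorPC.target] using hki.symm)
  target k hk := hC.target k (hpc ▸ hk)
  propagator := by
    obtain ⟨ho, hpb⟩ : _ ∧ _ := hpc ▸ hC.propagator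
    exact ⟨ho, hpb, by simp [OptState.setLocal, OptState.vars, UpdateVars.aux]⟩
  query := hC.query

theorem setProp (hC : Coupled b s gst G) {i : Fin N} {h : Hint}
    (hpc : s.propagatorPC = .setProp i h) :
    Coupled b { s with prop := Function.update s.prop i h, propagatorPC := .scan } gst G := by
  obtain ⟨ho, hh, hpb, haux⟩ : _ ∧ _ ∧ _ ∧ _ := hpc ▸ hC.propagator
  refine ⟨fun k => ?_, fun k _ => ?_, fun k hk => (nomatch hk), ho, hC.query⟩
  · have hk := hC.update k
    rcases eq_or_ne k i with rfl | hki
    · rw [hpb] at hk ⊢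
      simpa [OptState.vars] using hk.setProp (hC.target k (by simp [hpc, PropagatorPC.target])) hh
    · simpa [OptState.vars, hki] using hk
  · rcases eq_or_ne k i with rfl | hki
    · rw [hpb]
      exact haux
    · exact hC.aux k (by simpa [hpc, PropagatorPC.target] using hki.symm)

theorem merged (hC : Coupled b s gst G) {i : Fin N} (hpc : s.propagatorPC = .merging i) {p : ℕ}
    {x : GlobalInv S.State} {r : GlobalRes S.State Hint}
    (hdone : gst .propagator = .done p x r) (g : S.shared.Config) :
    Coupled b { s with globalS := g, propagatorPC := .emptyLocal i }
      (Function.update gst .propagator .idle) G := by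
  obtain ⟨q, hpending | ⟨-, hpublished⟩⟩ : PropagatorInv _ _ _ _ _ (.merging i) :=
    hpc ▸ hC.propagator
  · simp [hdone] at hpending
  · exact hC.of_propagator g (hpc ▸ rfl) ⟨rfl, hpublished⟩

theorem calculated (hC : Coupled b s gst G) {i : Fin N} (hpc : s.propagatorPC = .calculating i)
    {p : ℕ} {x : GlobalInv S.State} {h : Hint} (hdone : gst .propagator = .done p x (.hint h))
    (g : S.shared.Config) :
    Coupled b { s with globalS := g, propagatorPC := .setProp i h }
      (Function.update gst .propagator .idle) G := by
  obtain ⟨⟨q, hpending | ⟨h', ho, hh⟩⟩, hi⟩ : PropagatorInv _ _ _ _ _ (.calculating i) :=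
    hpc ▸ hC.propagator
  · simp [hdone] at hpending
  · obtain rfl : h = h' := by simp_all
    exact hC.of_propagator g (hpc ▸ rfl) ⟨rfl, hh, hi⟩

theorem copied (hC : Coupled b s gst G) {j : Q} {x : Arg} (hpc : s.queryPC j = .snapshotting x)
    {p : ℕ} {i : GlobalInv S.State} {y : S.State} (hdone : gst (.query j) = .done p i (.copy y))
    (g : S.shared.Config) :
    Coupled b ({ s with globalS := g }.gotoQ j (.respond x y))
      (Function.update gst (.query j) .idle) G := by
  obtain ⟨q, q', ⟨-, hpending⟩ | ⟨z, ho, hcopy⟩⟩ : QueryInv _ _ _ (.snapshotting x) :=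
    hpc ▸ hC.query j
  · simp [hdone] at hpending
  · obtain rfl : y = z := by simp_all
    exact hC.of_query g ⟨⟨q, ho⟩, rfl⟩

theorem publish (hC : Coupled b s gst G) {i : Fin N} (hpc : s.propagatorPC = .merging i)
    (p : ℕ) (x : S.State) (r : GlobalRes S.State Hint) :
    Coupled b s (Function.update gst .propagator (.done p (.merge x) r)) (G.publish i) where
  update k := by
    have hk := (hC.update k).mono
      (stream_isPrefix_stream (List.prefix_append G.visible (G.handed i)))
    rcases eq_or_ne k i with rfl | hki
    · simpa [Ledger.publish] using hk.publish (hC.target k (by simp [hpc, PropagatorPC.target]))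
    · simpa [Ledger.publish, hki] using hk
  aux k hk := by
    have hki : k ≠ i := by simpa [hpc, PropagatorPC.target, eq_comm] using hk
    simpa [Ledger.publish, hki] using hC.aux k hk
  target := hC.target
  propagator := by
    rw [hpc, Function.update_self]
    exact ⟨p, .inr ⟨⟨x, r, rfl⟩, Function.update_self ..⟩⟩
  query j := by
    rw [Function.update_of_ne (by simp)]
    exact hC.query j

theorem exposeQuery (hC : Coupled b s gst G) {j : Q} {x : Arg}
    (hpc : s.queryPC j = .snapshotting x) (p q : ℕ) (y : S.State) :
    Coupled b s (Function.update gst (.query j) (.done q .snapshot (.copy y)))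
      (G.expose ⟨p, .query j, .query x, .value (S.query y x)⟩) where
  update k := by
    simpa [Ledger.expose, Ledger.linearise, Ledger.setOp] using
      (hC.update k).mono (stream_isPrefix_stream (List.prefix_append G.visible _))
  aux := hC.aux
  target := hC.target
  propagator := by
    rw [Function.update_of_ne (by simp)]
    exact hC.propagator.congr (stream_isPrefix_stream (List.prefix_append G.visible _))
      fun _ _ => ⟨rfl, rfl⟩
  query k := by
    rcases eq_or_ne k j with rfl | hkj
    · rw [hpc]
      exact ⟨p, q, .inr ⟨y, Function.update_self .., Function.update_self ..⟩⟩
    · simpa [Ledger.expose, Ledger.linearise, Ledger.setOp, hkj] using hC.query k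

end Coupled

end Coupling

section Simulation

variable {Elem Arg Val Hint Q : Type*} [Zero Hint] [One Hint] [DecidableEq Q]
  {S : ComposableSketch Elem Arg Val Hint Q} {N b : ℕ}

/-- The state `s`, reached with history `h`, is described by the statuses `gst` of the operations
on the global sketch, the linearisation `L` of these operations, and the ledger `G`. -/
structure OptInv (b : ℕ) (s : OptState S N)
    (h : List (Event (OptThread N Q) (SketchInv Elem Arg) (SketchRes Val)))
    (gst : GlobalThread Q → S.GlobalOp)
    (L : SeqHistory (GlobalThread Q) (GlobalInv S.State) (GlobalRes S.State Hint))
    (G : Ledger (OptThread N Q) (Fin N) Elem Arg Val) : Prop where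
  valid : G.Valid S.toSketchMethods b h
  coupled : Coupled b s gst G
  globalFinal_eq : S.globalFinal S.empty L = S.summary (stream G.visible)

variable {s s' : OptState S N}
  {h : List (Event (OptThread N Q) (SketchInv Elem Arg) (SketchRes Val))}
  {gst gst' : GlobalThread Q → S.GlobalOp}
  {L M : SeqHistory (GlobalThread Q) (GlobalInv S.State) (GlobalRes S.State Hint)}
  {G : Ledger (OptThread N Q) (Fin N) Elem Arg Val}

namespace OptInv

theorem init (hb : 0 < b) : OptInv b (OptState.init S N) [] (fun _ => .idle) []
    ⟨fun _ => .idle, [], [], fun _ => [], fun _ => []⟩ where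
  valid :=
    { linearises := .nil
      account := by simp
      early := fun k hk => nomatch hk
      run := trivial
      current := fun _ => .nil
      handed := fun _ => .nil }
  coupled :=
    { update := fun i =>
        { op := rfl
          count := ⟨rfl, hb⟩
          current := rfl
          hint := S.isHintFor_one []
          prop := fun _ => S.isHintFor_one []
          handover := fun _ => rfl }
      aux := fun _ _ => rfl
      target := fun _ hi => nomatch hi
      propagator := rfl
      query := fun _ => ⟨rfl, rfl⟩ }
  globalFinal_eq := rfl

variable {c : Call (GlobalThread Q) (GlobalInv S.State) (GlobalRes S.State Hint)}

theorem takeEffect_propagator (hI : OptInv b s h gst L G) (ht : c.thread = .propagator)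
    (hc : gst c.thread = .pending c.id c.inv)
    (hrun : S.GlobalRun (S.globalFinal S.empty L) [c]) :
    ∃ G', G.linearised <+: G'.linearised ∧
      OptInv b s h (Function.update gst c.thread (.done c.id c.inv c.res)) (L ++ [c]) G' := by
  obtain ⟨p, t, x, r⟩ := c
  obtain rfl : t = .propagator := ht
  rw [hI.globalFinal_eq] at hrun
  have hP : PropagatorInv _ (.pending p x) _ _ _ _ := hc ▸ hI.coupled.propagator
  rcases hP.exists_of_pending with ⟨i, hpc, rfl⟩ | ⟨i, hpc, rfl⟩
  · refine ⟨G.publish i, List.prefix_rfl, hI.valid.publish i, hI.coupled.publish hpc p _ r, ?_⟩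
    rw [SketchMethods.globalFinal_append, hI.globalFinal_eq]
    exact (S.merge_summary _ _).trans (congrArg S.summary (stream_append _ _).symm)
  · obtain rfl : r = .hint (S.calcHint (S.summary (stream G.visible))) := hrun.1
    refine ⟨G, List.prefix_rfl, hI.valid,
      hI.coupled.of_propagator (pc := s.propagatorPC) s.globalS rfl ?_,
      (SketchMethods.globalFinal_append _ _ _).trans hI.globalFinal_eq⟩
    rw [hpc] at hP ⊢
    exact ⟨⟨p, .inr ⟨_, rfl, S.isHintFor_calcHint _⟩⟩, hP.2⟩

theorem takeEffect_query (hI : OptInv b s h gst L G) {j : Q} (ht : c.thread = .query j)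
    (hc : gst c.thread = .pending c.id c.inv)
    (hrun : S.GlobalRun (S.globalFinal S.empty L) [c]) :
    ∃ G', G.linearised <+: G'.linearised ∧
      OptInv b s h (Function.update gst c.thread (.done c.id c.inv c.res)) (L ++ [c]) G' := by
  obtain ⟨q, t, i, r⟩ := c
  obtain rfl : t = .query j := ht
  rw [hI.globalFinal_eq] at hrun
  have hQ : QueryInv _ _ (.pending q i) _ := hc ▸ hI.coupled.query j
  obtain ⟨x, p, hpc, ho, rfl⟩ := hQ.exists_of_pending
  obtain ⟨⟨y, rfl, hy⟩, -⟩ := hrun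
  refine ⟨G.expose ⟨p, .query j, .query x, .value (S.query y x)⟩, List.prefix_append _ _,
    hI.valid.expose ho ⟨congrArg SketchRes.value (hy x), trivial⟩,
    hI.coupled.exposeQuery hpc p q y, ?_⟩
  rw [SketchMethods.globalFinal_append, hI.globalFinal_eq]
  exact congrArg S.summary ((stream_append _ _).trans (List.append_nil _)).symm

theorem takeEffect (hI : OptInv b s h gst L G) (hM : TakeEffect gst M gst')
    (hrun : S.GlobalRun S.empty (L ++ M)) :
    ∃ G', G.linearised <+: G'.linearised ∧ OptInv b s h gst' (L ++ M) G' := by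
  induction hM generalizing L G with
  | nil => exact ⟨G, List.prefix_rfl, by rwa [List.append_nil]⟩
  | @cons _ c M _ hc _ ih =>
    rw [← List.singleton_append, ← List.append_assoc] at hrun ⊢
    have hrunc := (SketchMethods.globalRun_append.1 (SketchMethods.globalRun_append.1 hrun).1).2
    obtain ⟨G', hG', hI'⟩ : ∃ G', G.linearised <+: G'.linearised ∧
        OptInv b s h (Function.update _ c.thread (.done c.id c.inv c.res)) (L ++ [c]) G' := by
      cases ht : c.thread with
      | propagator => exact ht ▸ hI.takeEffect_propagator ht hc hrunc
      | query j => exact ht ▸ hI.takeEffect_query ht hc hrunc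
    obtain ⟨G'', hG'', hI''⟩ := ih hI' hrun
    exact ⟨G'', hG'.trans hG'', hI''⟩

theorem of_update (hI : OptInv b s h gst L G) {i : Fin N} (hs : s.AgreeOff i s')
    (hinv : UpdateInv S.toSketchMethods b (s'.updatePC i) (s'.vars i) (G.ops (.update i))
      (stream G.visible) (G.current i) (G.handed i))
    (hprop : s.prop i = 0 → s'.prop i = 0) (haux : (s'.vars i).aux = (s.vars i).aux) :
    OptInv b s' h gst L G where
  valid := hI.valid
  coupled := hI.coupled.of_update_of_aux_eq hs
    ⟨fun _ _ => rfl, List.prefix_rfl, fun _ _ => rfl, fun _ _ => rfl⟩ hinv hprop haux rfl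
  globalFinal_eq := hI.globalFinal_eq

theorem update_invoke (hI : OptInv b s h gst L G) {i : Fin N} {x : SketchInv Elem Arg}
    (hstep : OptStep S N b s (.update i) (.inv x) s') :
    OptInv b s' (h ++ [.inv (.update i) x]) gst L (G.setOp (.update i) (.pending h.length x)) := by
  have hs := hstep.agreeOff
  cases hstep with | u_invoke i a hpc =>
  have hU : UpdateInv _ _ .idle _ _ _ _ _ := hpc ▸ hI.coupled.update i
  exact ⟨hI.valid.invoke hU.op _, hI.coupled.of_update_of_aux_eq hs
    ⟨fun t ht => Function.update_of_ne ht .., List.prefix_rfl, fun _ _ => rfl, fun _ _ => rfl⟩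
    (by simpa [OptState.vars, OptState.gotoU, Ledger.setOp] using hU.invoke h.length) id rfl rfl,
    hI.globalFinal_eq⟩

theorem update_respond (hI : OptInv b s h gst L G) {i : Fin N} {r : SketchRes Val}
    (hstep : OptStep S N b s (.update i) (.res r) s') :
    OptInv b s' (h ++ [.res (.update i) r]) gst L (G.setOp (.update i) .idle) := by
  have hs := hstep.agreeOff
  cases hstep with | u_respond i hpc =>
  have hU : UpdateInv _ _ .respond _ _ _ _ _ := hpc ▸ hI.coupled.update i
  obtain ⟨p, a, ho⟩ := hU.op
  exact ⟨hI.valid.respond ho, hI.coupled.of_update_of_aux_eq hs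
    ⟨fun t ht => Function.update_of_ne ht .., List.prefix_rfl, fun _ _ => rfl, fun _ _ => rfl⟩
    (by simpa [OptState.vars, OptState.gotoU, Ledger.setOp] using hU.respond) id rfl rfl,
    hI.globalFinal_eq⟩

theorem update_filter (hI : OptInv b s h gst L G) {i : Fin N} {a : Elem} {p : ℕ}
    (hpc : s.updatePC i = .shouldAdd a) (ho : G.ops (.update i) = .pending p (.update a))
    (hadd : S.shouldAdd (s.hint i) a = false) :
    OptInv b (s.gotoU i .respond) h gst L (G.expose ⟨p, .update i, .update a, .ack⟩) := by
  have hs := (OptStep.u_filter (b := b) s i a hpc hadd).agreeOff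
  have hU : UpdateInv _ _ (.shouldAdd a) _ _ _ _ _ := hpc ▸ hI.coupled.update i
  have hstream : stream (G.expose ⟨p, .update i, .update a, .ack⟩).visible =
      stream G.visible ++ [a] := stream_append _ _
  refine ⟨hI.valid.expose ho ⟨rfl, trivial⟩, hI.coupled.of_update_of_aux_eq hs
    ⟨fun t ht => Function.update_of_ne ht .., List.prefix_append _ _, fun _ _ => rfl,
      fun _ _ => rfl⟩ ?_ id rfl rfl, ?_⟩
  · rw [hstream]
    simpa [OptState.vars, OptState.gotoU, Ledger.expose, Ledger.linearise, Ledger.setOp] using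
      hU.filter p
  · have hsummary := hU.hint a hadd []
    rw [List.append_nil] at hsummary
    rw [hI.globalFinal_eq, hstream, hsummary]

theorem update_updateLocal (hI : OptInv b s h gst L G) {i : Fin N} {a : Elem} {p : ℕ}
    (hpc : s.updatePC i = .updateLocal a) (ho : G.ops (.update i) = .pending p (.update a)) :
    OptInv b ((s.setLocal i (s.cur i) (S.update (s.localS i (s.cur i)) a)).gotoU i .checkFull)
      h gst L (G.buffer i ⟨p, .update i, .update a, .ack⟩) := by
  have hs := (OptStep.u_updateLocal (b := b) s i a hpc).agreeOff
  have hU : UpdateInv _ _ (.updateLocal a) _ _ _ _ _ := hpc ▸ hI.coupled.update i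
  refine ⟨hI.valid.buffer ho ⟨⟨a, rfl⟩, rfl⟩ hU.count.2, hI.coupled.of_update_of_aux_eq hs
    ⟨fun t ht => Function.update_of_ne ht .., List.prefix_rfl,
      fun k hk => Function.update_of_ne hk .., fun _ _ => rfl⟩ ?_ id ?_ rfl, hI.globalFinal_eq⟩
  · simpa [OptState.vars, OptState.gotoU, OptState.setLocal, Ledger.buffer, Ledger.linearise,
      Ledger.setOp] using hU.updateLocal p (.update i)
  · simp [OptState.vars, OptState.gotoU, OptState.setLocal, UpdateVars.aux]

theorem update_swap (hI : OptInv b s h gst L G) {i : Fin N} (hpc : s.updatePC i = .swap) :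
    OptInv b ({ s with cur := Function.update s.cur i (!s.cur i) }.gotoU i .updateHint) h gst L
      (G.swap i) := by
  have hs := (OptStep.u_swap (b := b) s i hpc).agreeOff
  have hU : UpdateInv _ _ .swap _ _ _ _ _ := hpc ▸ hI.coupled.update i
  have hswap := hU.swap (hI.coupled.aux i (hI.coupled.target_ne hU.handover.1))
  refine ⟨hI.valid.swap hU.handover.2, hI.coupled.of_update hs
    ⟨fun _ _ => rfl, List.prefix_rfl, fun k hk => Function.update_of_ne hk ..,
      fun k hk => Function.update_of_ne hk ..⟩ ?_ (fun h => absurd h hU.handover.1) fun _ => ?_,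
    hI.globalFinal_eq⟩
  · simpa [OptState.vars, OptState.gotoU, Ledger.swap] using hswap
  · simpa [OptState.vars, OptState.gotoU, Ledger.swap, UpdateVars.aux] using hU.current

theorem update_tau (hI : OptInv b s h gst L G) (hb : 0 < b) {i : Fin N}
    (hstep : OptStep S N b s (.update i) .tau s') :
    ∃ G', G.linearised <+: G'.linearised ∧ OptInv b s' h gst L G' := by
  have hs := hstep.agreeOff
  have hU {pc} (hpc : s.updatePC i = pc) : UpdateInv S.toSketchMethods b pc (s.vars i)
      (G.ops (.update i)) (stream G.visible) (G.current i) (G.handed i) :=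
    hpc ▸ hI.coupled.update i
  have unchanged {s'} (hI' : OptInv b s' h gst L G) :
      ∃ G', G.linearised <+: G'.linearised ∧ OptInv b s' h gst L G' :=
    ⟨G, List.prefix_rfl, hI'⟩
  cases hstep with
  | u_filter _ a hpc hadd =>
    obtain ⟨p, ho⟩ := (hU hpc).op
    exact ⟨_, List.prefix_append _ _, hI.update_filter hpc ho hadd⟩
  | u_updateLocal _ a hpc =>
    obtain ⟨p, ho⟩ := (hU hpc).op
    exact ⟨_, List.prefix_append _ _, hI.update_updateLocal hpc ho⟩
  | u_swap _ hpc => exact ⟨G.swap i, List.prefix_rfl, hI.update_swap hpc⟩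
  | u_add _ a hpc _ =>
    refine unchanged (hI.of_update hs ?_ id rfl)
    simpa [OptState.vars, OptState.gotoU] using (hU hpc).add
  | u_incCounter _ a hpc =>
    refine unchanged (hI.of_update hs ?_ id rfl)
    simpa [OptState.vars, OptState.gotoU] using (hU hpc).incCounter
  | u_notFull _ hpc hne =>
    refine unchanged (hI.of_update hs ?_ id rfl)
    simpa [OptState.vars, OptState.gotoU] using (hU hpc).notFull hne
  | u_full _ hpc _ =>
    refine unchanged (hI.of_update hs ?_ id rfl)
    simpa [OptState.vars, OptState.gotoU] using (hU hpc).full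
  | u_wait _ hpc hprop =>
    refine unchanged (hI.of_update hs ?_ id rfl)
    simpa [OptState.vars, OptState.gotoU] using (hU hpc).wait hprop
  | u_updateHint _ hpc =>
    refine unchanged (hI.of_update hs ?_ id rfl)
    simpa [OptState.vars, OptState.gotoU] using (hU hpc).updateHint
  | u_zeroCounter _ hpc =>
    refine unchanged (hI.of_update hs ?_ id rfl)
    simpa [OptState.vars, OptState.gotoU] using (hU hpc).zeroCounter
  | u_signal _ hpc =>
    refine unchanged (hI.of_update hs ?_ (fun _ => Function.update_self ..) rfl)
    simpa [OptState.vars, OptState.gotoU] using (hU hpc).signal hb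

end OptInv

/-- The state `s`, reached with history `h`, is related to the linearisation `H` of `h`. -/
def OptSim (GSim : SimRel (S.shared.toAlgorithm S.GlobalAllowed)) (b : ℕ) (s : OptState S N)
    (h : List (Event (OptThread N Q) (SketchInv Elem Arg) (SketchRes Val)))
    (H : SketchHistory (OptThread N Q) Elem Arg Val) : Prop :=
  ∃ gst L G, G.linearised = H ∧ OptInv b s h gst L G ∧ Tracks GSim s.globalS gst L

variable {GSim : SimRel (S.shared.toAlgorithm S.GlobalAllowed)}

section

variable (hGSim : IsForwardSimulation (S.shared.toAlgorithm S.GlobalAllowed)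
    {H | S.GlobalRun S.empty H} GSim)
  (hI : OptInv b s h gst L G)
  (hT : Tracks GSim s.globalS gst L)
  {g : S.shared.Config} {t : GlobalThread Q}

include hGSim hI hT

theorem OptInv.shared_tau (hstep : S.SharedStep s.globalS t .tau g) :
    ∃ H, G.linearised <+: H ∧ OptSim GSim b { s with globalS := g } h H := by
  obtain ⟨M, gst', hM, hT'⟩ := hGSim.tracks_tau hT (hstep.imp fun _ hi => nomatch hi)
  obtain ⟨G', hpre, hI'⟩ := hI.takeEffect hM (hGSim.mem_of_tracks hT')
  exact ⟨_, hpre, gst', _, G', rfl,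
    ⟨hI'.valid, hI'.coupled.setGlobalS g, hI'.globalFinal_eq⟩, hT'⟩

theorem OptInv.shared_invoke {x : GlobalInv S.State}
    (hstep : S.SharedStep s.globalS t (.inv x) g) (hx : S.GlobalAllowed t x)
    (ht : gst t = .idle) (hs' : s'.globalS = g)
    (hC : ∀ p, Coupled b s' (Function.update gst t (.pending p x)) G) :
    ∃ H, G.linearised <+: H ∧ OptSim GSim b s' h H := by
  obtain ⟨p, M, gst', hM, hT'⟩ := hGSim.tracks_invoke hT
    (hstep.imp (by rintro _ ⟨⟩; exact hx)) ht
  obtain ⟨G', hpre, hI'⟩ := OptInv.takeEffect ⟨hI.valid, hC p, hI.globalFinal_eq⟩ hM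
    (hGSim.mem_of_tracks hT')
  exact ⟨_, hpre, gst', _, G', rfl, hI', hs' ▸ hT'⟩

theorem OptInv.shared_respond {r : GlobalRes S.State Hint}
    (hstep : S.SharedStep s.globalS t (.res r) g) (ht : gst t ≠ .idle) (hs' : s'.globalS = g)
    (hC : ∀ {gst' G' p x}, gst' t = .done p x r → Coupled b s gst' G' →
      Coupled b s' (Function.update gst' t .idle) G') :
    ∃ H, G.linearised <+: H ∧ OptSim GSim b s' h H := by
  obtain ⟨M, gst', p, x, hM, hdone, hT'⟩ := hGSim.tracks_respond hT
    (hstep.imp fun _ hi => nomatch hi) ht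
  obtain ⟨G', hpre, hI'⟩ := hI.takeEffect hM (hGSim.mem_of_tracks hT')
  exact ⟨_, hpre, _, _, G', rfl,
    ⟨hI'.valid, hC hdone hI'.coupled, hI'.globalFinal_eq⟩, hs' ▸ hT'⟩

end

namespace OptSim

variable (hGSim : IsForwardSimulation (S.shared.toAlgorithm S.GlobalAllowed)
    {H | S.GlobalRun S.empty H} GSim)
  {H : SketchHistory (OptThread N Q) Elem Arg Val}
  {α : StepAction (SketchInv Elem Arg) (SketchRes Val)}

theorem update_step (hb : 0 < b) (hsim : OptSim GSim b s h H) {i : Fin N}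
    (hstep : OptStep S N b s (.update i) α s') :
    ∃ H', H <+: H' ∧ OptSim GSim b s' (h ++ (α.event? (.update i)).toList) H' := by
  obtain ⟨gst, L, G, rfl, hI, hT⟩ := hsim
  rw [← hstep.agreeOff.globalS] at hT
  cases α with
  | inv x => exact ⟨_, List.prefix_rfl, gst, L, G.setOp .., rfl, hI.update_invoke hstep, hT⟩
  | res r => exact ⟨_, List.prefix_rfl, gst, L, G.setOp .., rfl, hI.update_respond hstep, hT⟩
  | tau =>
    obtain ⟨G', hpre, hI'⟩ := hI.update_tau hb hstep
    exact ⟨_, hpre, gst, L, G', rfl, by simpa [StepAction.event?] using hI', hT⟩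

include hGSim

theorem propagator_step (hsim : OptSim GSim b s h H) (hstep : OptStep S N b s .propagator α s') :
    ∃ H', H <+: H' ∧ OptSim GSim b s' (h ++ (α.event? .propagator).toList) H' := by
  obtain ⟨gst, L, G, rfl, hI, hT⟩ := hsim
  have hP := hI.coupled.propagator
  have unshared {s'} (hs' : s'.globalS = s.globalS) (hC : Coupled b s' gst G) :
      ∃ H', G.linearised <+: H' ∧ OptSim GSim b s' h H' :=
    ⟨_, List.prefix_rfl, gst, L, G, rfl, ⟨hI.valid, hC, hI.globalFinal_eq⟩, hs' ▸ hT⟩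
  cases hstep <;> simp only [StepAction.event?, Option.toList_none, List.append_nil]
  case p_select i hpc hprop => exact unshared rfl (hI.coupled.select hpc hprop)
  case p_emptyLocal i hpc => exact unshared rfl (hI.coupled.emptyLocal hpc)
  case p_setProp i x hpc => exact unshared rfl (hI.coupled.setProp hpc)
  case p_merging i g hpc hg => exact hI.shared_tau hGSim hT hg
  case p_calculating i g hpc hg => exact hI.shared_tau hGSim hT hg
  case p_merge i g hpc hg =>
    obtain ⟨ho, haux⟩ : _ ∧ _ := hpc ▸ hP
    exact hI.shared_invoke hGSim hT hg ⟨_, haux⟩ ho rfl fun p => hI.coupled.of_propagator g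
      (hpc ▸ rfl) ⟨p, .inl (congrArg (fun y => OpStatus.pending p (GlobalInv.merge y)) haux)⟩
  case p_calcHint i g hpc hg =>
    obtain ⟨ho, hi⟩ : _ ∧ _ := hpc ▸ hP
    exact hI.shared_invoke hGSim hT hg trivial ho rfl fun p =>
      hI.coupled.of_propagator g (hpc ▸ rfl) ⟨⟨p, .inl rfl⟩, hi⟩
  case p_merged i g r hpc hg =>
    have ho : gst .propagator ≠ .idle := by
      rintro ho
      simp [hpc, ho, PropagatorInv] at hP
    exact hI.shared_respond hGSim hT hg ho rfl fun hdone hC => hC.merged hpc hdone g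
  case p_calculated i g x hpc hg =>
    have ho : gst .propagator ≠ .idle := by
      rintro ho
      simp [hpc, ho, PropagatorInv] at hP
    exact hI.shared_respond hGSim hT hg ho rfl fun hdone hC => hC.calculated hpc hdone g

theorem query_step (hsim : OptSim GSim b s h H) {j : Q}
    (hstep : OptStep S N b s (.query j) α s') :
    ∃ H', H <+: H' ∧ OptSim GSim b s' (h ++ (α.event? (.query j)).toList) H' := by
  obtain ⟨gst, L, G, rfl, hI, hT⟩ := hsim
  have hQ := hI.coupled.query j
  cases hstep <;>
    simp only [StepAction.event?, Option.toList_some, Option.toList_none, List.append_nil]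
  case q_invoke x hpc =>
    obtain ⟨ho, hg⟩ : _ ∧ _ := hpc ▸ hQ
    exact ⟨_, List.prefix_rfl, gst, L, G.setOp .., rfl, ⟨hI.valid.invoke ho _,
      hI.coupled.setQueryOp ⟨⟨_, rfl⟩, hg⟩, hI.globalFinal_eq⟩, hT⟩
  case q_respond x y hpc =>
    obtain ⟨⟨p, ho⟩, hg⟩ : _ ∧ _ := hpc ▸ hQ
    exact ⟨_, List.prefix_rfl, gst, L, G.setOp .., rfl, ⟨hI.valid.respond ho,
      hI.coupled.setQueryOp ⟨rfl, hg⟩, hI.globalFinal_eq⟩, hT⟩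
  case q_snapshotting x g hpc hg => exact hI.shared_tau hGSim hT hg
  case q_snapshot x g hpc hg =>
    obtain ⟨⟨p, ho⟩, hidle⟩ : _ ∧ _ := hpc ▸ hQ
    exact hI.shared_invoke hGSim hT hg trivial hidle rfl fun q =>
      hI.coupled.of_query g ⟨p, q, .inl ⟨ho, rfl⟩⟩
  case q_copied x g y hpc hg =>
    have hne : gst (.query j) ≠ .idle := by
      rintro hidle
      simp [hpc, hidle, QueryInv] at hQ
    exact hI.shared_respond hGSim hT hg hne rfl fun hdone hC => hC.copied hpc hdone g

theorem isForwardSimulation (hb : 0 < b) : IsForwardSimulation (OptParSketch S N b)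
    (Relaxed (SeqSketch S.toSketchMethods (OptThread N Q)) (2 * N * b)) (OptSim GSim b) where
  init := ⟨_, _, _, rfl, .init hb, hGSim.tracks_init⟩
  step {_ t _ _ _ _} hstep hsim := by
    cases t with
    | update i => exact hsim.update_step hb hstep
    | propagator => exact hsim.propagator_step hGSim hstep
    | query j => exact hsim.query_step hGSim hstep
  sound := by
    rintro _ _ _ ⟨_, _, G, rfl, hI, _⟩
    exact ⟨by simpa only [Fintype.card_fin] using hI.valid.mem_relaxed,
      hI.valid.linearises.isSerialisation⟩

end OptSim

end Simulation

theorem mainTheorem1 {Elem Arg Val Hint Q : Type*} [Zero Hint] [One Hint] [NeZero (1 : Hint)]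
    [DecidableEq Q] (S : ComposableSketch Elem Arg Val Hint Q) (N b : ℕ) (hb : 0 < b) :
    StronglyLinearisable (OptParSketch S N b)
      (Relaxed (SeqSketch S.toSketchMethods (OptThread N Q)) (2 * N * b)) := by
  obtain ⟨GSim, hGSim⟩ := S.shared_stronglyLinearisable.exists_isForwardSimulation
  exact (OptSim.isForwardSimulation hGSim hb).stronglyLinearisable
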